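/- Theorem 1. Let $n$ be a natural number, let $(x_1,y_1,\dots,x_n,y_n)$ and $(x_1,y_1,\dots,x_n,y_n,z)$ be the coordinates of $\mathbb R^{2n}$ and $\mathbb R^{2n+1}$, and let $(r_j,\theta_j)$ be the polar coordinates in the $(x_j,y_j)$-plane. Let $\alpha_{\mathrm{st}}=dz+\frac12\sum_{j=1}^n(x_j\,dy_j-y_j\,dx_j)$ be the standard contact form and $\xi_{\mathrm{st}}=\ker\alpha_{\mathrm{st}}$ the standard contact structure on $\mathbb R^{2n+1}$, and let $\mathbb T=\{r_1=\dots=r_n=1\}\subset\mathbb R^{2n}$. A $C^\infty$ $1$-form $\alpha$ on $\mathbb R^{2n+1}$ is a contact form if $\alpha\wedge(d\alpha)^n$ vanishes nowhere; its Reeb vector field $R$ is the unique vector field with $\alpha(R)=1$ and $i(R)\,d\alpha=0$. Let $V$ be a $C^\infty$ vector field on $\mathbb T$ (tangent to $\mathbb T$) with $\sum_{j=1}^n d\theta_j(V)>0$ at every point of $\mathbb T$, and let $\mathcal A\subset\mathbb T$ be a nonempty compact set that is invariant under the flow generated by $V$. Then there is a $C^\infty$ contact form $\alpha$ on $\mathbb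 R^{2n+1}$ with $\ker\alpha=\xi_{\mathrm{st}}$ whose Reeb vector field $R$ generates a flow $\varphi=(\varphi_t)_{t\in\mathbb R}$ defined for all times, such that: (1) there is a compact neighbourhood of $\mathcal A\times\{0\}$ in $\mathbb R^{2n+1}$ outside which $\alpha=\alpha_{\mathrm{st}}$; (2) $\mathcal A\times\{0\}$ is invariant under $\varphi$, and there is a positive $C^\infty$ function $f$ on $\mathbb T$ such that $R=fV$ on $\mathcal A\times\{0\}$; (3) every orbit $\{\varphi_t(q) : t\in\mathbb R\}$ with $q\in\mathbb R^{2n+1}\setminus(\mathcal A\times\{0\})$ is unbounded; (4) there is a point $q\in\mathbb R^{2n+1}$ such that $\{\varphi_t(q): t\ge 0\}$ is bounded and $\{\varphi_t(q): t\le 0\}$ is unbounded. -/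

import Mathlib

open Set Filter
open scoped Topology ContDiff

namespace ReebTorus

noncomputable section

/-- `ℝ^{2n}` with coordinates `(x_1, y_1, …, x_n, y_n)`: for a point `p`, `x_j = (p j).1` and
`y_j = (p j).2`. -/
abbrev Plane (n : ℕ) : Type := Fin n → ℝ × ℝ

/-- `ℝ^{2n+1}` with coordinates `(x_1, y_1, …, x_n, y_n, z)`: for a point `q`, `x_j = (q.1 j).1`,
`y_j = (q.1 j).2` and `z = q.2`. -/
abbrev Space (n : ℕ) : Type := Plane n × ℝ

/-! ### Differential 1-forms on a real normed space -/

section Forms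

variable {E : Type*} [NormedAddCommGroup E] [NormedSpace ℝ E]

/-- The exterior derivative of a 1-form, as a bilinear function `dα_x(v, w)`. -/
def extD (α : E → E →L[ℝ] ℝ) (x v w : E) : ℝ :=
  extDeriv (fun y => ContinuousAlternatingMap.ofSubsingleton ℝ E ℝ (0 : Fin 1) (α y)) x ![v, w]

/-- The usual formula `dα(v, w) = (D_v α)(w) - (D_w α)(v)`. -/
theorem extD_eq {α : E → E →L[ℝ] ℝ} {x : E} (h : DifferentiableAt ℝ α x) (v w : E) :
    extD α x v w = fderiv ℝ α x v w - fderiv ℝ α x w v := by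
  have hc := ((ContinuousAlternatingMap.ofSubsingletonLIE (𝕜 := ℝ) (E := E) (F := ℝ)
    (0 : Fin 1)).toContinuousLinearEquiv.hasFDerivAt (x := α x)).comp x h.hasFDerivAt
  have hf : fderiv ℝ (fun y => ContinuousAlternatingMap.ofSubsingleton ℝ E ℝ (0 : Fin 1) (α y)) x
      = _ := hc.fderiv
  unfold extD extDeriv
  rw [hf, ContinuousAlternatingMap.alternatizeUncurryFin_apply]
  simp [Fin.sum_univ_two, sub_eq_add_neg, Fin.removeNth]

/-- The top-degree form `(α ∧ (dα)^n)_x (v_0, …, v_{2n})`, written out as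
`2⁻ⁿ ∑_σ sgn(σ) α(v_{σ(0)}) ∏_{i<n} dα(v_{σ(2i+1)}, v_{σ(2i+2)})`, the sum being over all
permutations `σ` of `{0, …, 2n}`. -/
def wedgeTop (n : ℕ) (α : E → E →L[ℝ] ℝ) (x : E) (v : Fin (2 * n + 1) → E) : ℝ :=
  (1 / 2 : ℝ) ^ n * ∑ σ : Equiv.Perm (Fin (2 * n + 1)),
    ((Equiv.Perm.sign σ : ℤ) : ℝ) * α x (v (σ 0)) *
      ∏ i : Fin n, extD α x (v (σ ⟨2 * (i : ℕ) + 1, by omega⟩)) (v (σ ⟨2 * (i : ℕ) + 2, by omega⟩))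

/-- `R` is the Reeb vector field of `α`: `α(R) = 1` and `i(R)dα = 0`. -/
def IsReebField (α : E → E →L[ℝ] ℝ) (R : E → E) : Prop :=
  ∀ x, α x (R x) = 1 ∧ ∀ w, extD α x (R x) w = 0

/-- The flow `φ` is generated by the (complete) vector field `R`. -/
def IsFlowOf (φ : Flow ℝ E) (R : E → E) : Prop :=
  ∀ x, IsIntegralCurve (fun t => φ t x) (fun _ => R)

end Forms

/-- A `C^∞` 1-form `α` on `ℝ^{2n+1}` is a contact form if `α ∧ (dα)^n` vanishes nowhere. -/
def IsContactForm (n : ℕ) (α : Space n → Space n →L[ℝ] ℝ) : Prop :=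
  ContDiff ℝ ∞ α ∧ ∀ x, ∃ v, wedgeTop n α x v ≠ 0

/-- The 1-form `dx_j` on `ℝ^{2n+1}`. -/
def dx (n : ℕ) (j : Fin n) : Space n →L[ℝ] ℝ :=
  (ContinuousLinearMap.fst ℝ ℝ ℝ).comp
    ((ContinuousLinearMap.proj (R := ℝ) (φ := fun _ : Fin n => ℝ × ℝ) j).comp
      (ContinuousLinearMap.fst ℝ (Plane n) ℝ))

/-- The 1-form `dy_j` on `ℝ^{2n+1}`. -/
def dy (n : ℕ) (j : Fin n) : Space n →L[ℝ] ℝ :=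
  (ContinuousLinearMap.snd ℝ ℝ ℝ).comp
    ((ContinuousLinearMap.proj (R := ℝ) (φ := fun _ : Fin n => ℝ × ℝ) j).comp
      (ContinuousLinearMap.fst ℝ (Plane n) ℝ))

/-- The 1-form `dz` on `ℝ^{2n+1}`. -/
def dz (n : ℕ) : Space n →L[ℝ] ℝ :=
  ContinuousLinearMap.snd ℝ (Plane n) ℝ

/-- The standard contact form `α_st = dz + ½ ∑_j (x_j dy_j - y_j dx_j)`. -/
def alphaSt (n : ℕ) (q : Space n) : Space n →L[ℝ] ℝ :=
  dz n + (1 / 2 : ℝ) • ∑ j : Fin n, ((q.1 j).1 • dy n j - (q.1 j).2 • dx n j)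

/-- The standard contact structure `ξ_st = ker α_st`. -/
def xiSt (n : ℕ) (q : Space n) : Submodule ℝ (Space n) :=
  LinearMap.ker (alphaSt n q : Space n →ₗ[ℝ] ℝ)

/-- The form `α` defines the standard contact structure: `ker α = ξ_st` at every point. -/
def DefinesXiSt (n : ℕ) (α : Space n → Space n →L[ℝ] ℝ) : Prop :=
  ∀ q, LinearMap.ker (α q : Space n →ₗ[ℝ] ℝ) = xiSt n q

/-! ### The torus and its vector fields -/

/-- The torus `𝕋 = {r_1 = ⋯ = r_n = 1}` in `ℝ^{2n}`, where `r_j² = x_j² + y_j²`. -/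
def torus (n : ℕ) : Set (Plane n) :=
  {p | ∀ j, Real.sqrt ((p j).1 ^ 2 + (p j).2 ^ 2) = 1}

/-- The value `dθ_j(v)` of the angular form at `p`, on a tangent vector `v` of `ℝ^{2n}`. -/
def dTheta {n : ℕ} (j : Fin n) (p v : Plane n) : ℝ :=
  ((p j).1 * (v j).2 - (p j).2 * (v j).1) / ((p j).1 ^ 2 + (p j).2 ^ 2)

/-- `V` restricts to a `C^∞` vector field on `𝕋`: it is smooth along `𝕋`, and at each point of `𝕋`
it is tangent to `𝕋`, that is, `x_j dx_j(V) + y_j dy_j(V) = 0` for all `j`. The values of `V`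
outside `𝕋` play no role. -/
def IsTorusField (n : ℕ) (V : Plane n → Plane n) : Prop :=
  ContDiffOn ℝ ∞ V (torus n) ∧
    ∀ p ∈ torus n, ∀ j, (p j).1 * (V p j).1 + (p j).2 * (V p j).2 = 0

/-- `A ⊆ 𝕋` is invariant under the flow of the vector field `V` on `𝕋`: the integral curves in `𝕋`
that start in `A` stay in `A` for all times, positive and negative. -/
def IsInvariantIn (n : ℕ) (V : Plane n → Plane n) (A : Set (Plane n)) : Prop :=
  ∀ γ : ℝ → Plane n, (∀ t, γ t ∈ torus n) → IsIntegralCurve γ (fun _ => V) →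
    γ 0 ∈ A → ∀ t, γ t ∈ A

end

end ReebTorus

open ReebTorus

/-!
The contact form is sought as `α = e^{-η} α_st` with `η` smooth and compactly supported. Its Reeb
field is the contact Hamiltonian vector field of `H = e^η` (`reebField`), with vertical component
`e^η (1 - ½ Eη)`, where `Eη = ∑_j (x_j η_{x_j} + y_j η_{y_j})` is the radial derivative.

The function `η` is chosen such that `Eη ≤ 2`, with equality exactly on `A × {0}`, and such that
`η = 0` and `dη = ∑_j f dθ_j(V) dr_j` on `A × {0}`, with `f = 2 / ∑_j dθ_j(V)`
(`exists_logHamiltonian`). Then `R = f V` on `A × {0}`, and the height `z` strictly increases along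
every orbit elsewhere. To find `η`, put `ℓ = ∑_j f dθ_j(V) log r_j`, with the coefficients extended
from the torus so as to depend on the angles only. As these coefficients add up to `2`, the function
`ℓ` has slope `2` along every ray through the origin of `ℝ^{2n}`. Take `η = c Ψ(ℓ)`, where
`Ψ : ℝ → ℝ` has compact support and `Ψ' ≤ 1` with equality only at `0`, and where the cutoff
`0 ≤ c ≤ 1` is constant along the rays and equal to `1` exactly on the rays through points of
`A × {0}`. Since `c` is constant along the rays, `Eη = 2 c Ψ'(ℓ)`.

The dynamical statements follow from the monotonicity of `z`. On a closed half-space that does not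
meet `{z = 0}` the height grows at a positive rate along any bounded half-orbit, by compactness, so
that no orbit off `A × {0}` is bounded (`not_isBounded_orbit`). Points just below `A × {0}` take
arbitrarily long to come up from the height `-1`, as `A × {0}` is never left; an accumulation point
of their starting points has a trapped forward orbit (`exists_trapped_orbit`). The set `A × {0}` is
invariant because integral curves of `f V` are time changes of those of `V`
(`exists_isIntegralCurve_smul`).
-/

/-! ### Flows of bounded Lipschitz vector fields -/

section FlowExistence

variable {E : Type*} [NormedAddCommGroup E] [NormedSpace ℝ E]

theorem IsIntegralCurve.eq_of_lipschitzWith {v : E → E} {K : NNReal} (hv : LipschitzWith K v)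
    {γ δ : ℝ → E} (hγ : IsIntegralCurve γ fun _ => v) (hδ : IsIntegralCurve δ fun _ => v)
    (h : γ 0 = δ 0) : γ = δ :=
  ODE_solution_unique_univ (v := fun _ => v) (s := fun _ => univ) (t₀ := 0)
    (fun _ => hv.lipschitzOnWith) (fun t => ⟨hγ t, trivial⟩) (fun t => ⟨hδ t, trivial⟩) h

/-- Boundedness of the field makes the Picard–Lindelöf theorem applicable on every interval
`[-k-1, k+1]`; the solutions on these intervals agree by uniqueness. -/
theorem exists_isIntegralCurve_of_lipschitzWith [CompleteSpace E] {v : E → E} {K : NNReal}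
    (hv : LipschitzWith K v) {C : ℝ} (hC : ∀ x, ‖v x‖ ≤ C) (x : E) :
    ∃ γ : ℝ → E, γ 0 = x ∧ IsIntegralCurve γ fun _ => v := by
  have hC0 : 0 ≤ C := (norm_nonneg _).trans (hC x)
  have key : ∀ k : ℕ, ∃ γ : ℝ → E, γ 0 = x ∧
      ∀ t ∈ Ioo (-(k + 1 : ℝ)) (k + 1), HasDerivAt γ (v (γ t)) t := by
    intro k
    have hk : (0 : ℝ) < k + 1 := by positivity
    have hP : IsPicardLindelof (fun _ => v) (tmin := -(k + 1 : ℝ)) (tmax := k + 1)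
        ⟨0, by constructor <;> linarith⟩ x (C.toNNReal * (k + 1)) 0 C.toNNReal K := by
      refine IsPicardLindelof.of_time_independent (fun y _ => ?_) hv.lipschitzOnWith ?_
      · rw [Real.coe_toNNReal _ hC0]
        exact hC y
      · simp
    obtain ⟨γ, h0, hγ⟩ := hP.exists_eq_forall_mem_Icc_hasDerivWithinAt₀
    exact ⟨γ, h0, fun t ht => (hγ t (Ioo_subset_Icc_self ht)).hasDerivAt (Icc_mem_nhds ht.1 ht.2)⟩
  choose γ h0 hγ using key
  have agree : ∀ k l : ℕ, k ≤ l → EqOn (γ k) (γ l) (Ioo (-(k + 1 : ℝ)) (k + 1)) := by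
    intro k l hkl
    have hkl' : (k : ℝ) ≤ l := by exact_mod_cast hkl
    have hk : (0 : ℝ) < k + 1 := by positivity
    refine ODE_solution_unique_of_mem_Ioo (v := fun _ => v) (s := fun _ => univ) (t₀ := 0)
      (fun _ _ => hv.lipschitzOnWith) ⟨by linarith, hk⟩ (fun t ht => ⟨hγ k t ht, trivial⟩)
      (fun t ht => ⟨hγ l t ⟨?_, ?_⟩, trivial⟩) ((h0 k).trans (h0 l).symm)
    · linarith [ht.1]
    · linarith [ht.2]
  have mem : ∀ t : ℝ, ∀ k : ℕ, |t| ≤ k → t ∈ Ioo (-(k + 1 : ℝ)) (k + 1) := fun t k h => by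
    rw [abs_le] at h
    constructor <;> linarith [h.1, h.2]
  refine ⟨fun t => γ ⌈|t|⌉₊ t, by simp [h0], fun t => ?_⟩
  set m : ℕ := ⌈|t|⌉₊ with hm
  have ht := mem t m (Nat.le_ceil _)
  refine (hγ m t ht).congr_of_eventuallyEq ?_
  filter_upwards [Ioo_mem_nhds ht.1 ht.2] with s hs
  rcases le_total ⌈|s|⌉₊ m with h | h
  · exact agree _ _ h (mem s _ (Nat.le_ceil _))
  · exact (agree _ _ h hs).symm

/-- A bounded globally Lipschitz vector field is complete, and generates a flow. -/
theorem exists_isFlowOf_of_lipschitzWith [CompleteSpace E] {v : E → E} {K : NNReal}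
    (hv : LipschitzWith K v) {C : ℝ} (hC : ∀ x, ‖v x‖ ≤ C) :
    ∃ φ : Flow ℝ E, IsFlowOf φ v := by
  choose γ h0 hγ using exists_isIntegralCurve_of_lipschitzWith hv hC
  have hdist : ∀ (x y : E) (t : ℝ), dist (γ x t) (γ y t) ≤ dist x y * Real.exp (K * |t|) := by
    -- Grönwall's inequality, forwards for `v` and, after time reversal, backwards
    have aux : ∀ (w : E → E), LipschitzWith K w → ∀ (γ δ : ℝ → E),
        IsIntegralCurve γ (fun _ => w) → IsIntegralCurve δ (fun _ => w) → ∀ t : ℝ, 0 ≤ t →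
        dist (γ t) (δ t) ≤ dist (γ 0) (δ 0) * Real.exp (K * t) := by
      intro w hw γ δ hγ hδ t ht
      have := dist_le_of_trajectories_ODE (v := fun _ => w) (a := 0) (b := t) (fun _ => hw)
        hγ.continuous.continuousOn (fun s _ => (hγ s).hasDerivWithinAt)
        hδ.continuous.continuousOn (fun s _ => (hδ s).hasDerivWithinAt) le_rfl t ⟨ht, le_rfl⟩
      simpa using this
    intro x y t
    rcases le_total 0 t with ht | ht
    · simpa [h0, abs_of_nonneg ht] using aux v hv _ _ (hγ x) (hγ y) t ht
    · have hneg : ∀ x, IsIntegralCurve (fun s => γ x (-s)) (fun _ z => -v z) := fun x s => by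
        simpa [Function.comp_def] using (hγ x (-s)).scomp s (hasDerivAt_neg s)
      simpa [h0, abs_of_nonpos ht] using aux (fun z => -v z) (by
        simpa [Function.comp_def] using LipschitzWith.id.neg.comp hv) _ _ (hneg x) (hneg y) (-t)
        (by linarith)
  refine ⟨⟨fun t x => γ x t, ?_, fun t s x => ?_, h0⟩, hγ⟩
  · rw [continuous_iff_continuousAt]
    rintro ⟨t, x⟩
    have h1 : Tendsto (fun p : ℝ × E => dist p.2 x * Real.exp (K * |p.1|)
        + dist (γ x p.1) (γ x t)) (𝓝 (t, x)) (𝓝 0) := by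
      have hc : Continuous (γ x) := (hγ x).continuous
      have : Continuous fun p : ℝ × E => dist p.2 x * Real.exp (K * |p.1|)
        + dist (γ x p.1) (γ x t) := by fun_prop
      simpa using this.tendsto (t, x)
    rw [ContinuousAt, tendsto_iff_dist_tendsto_zero]
    refine squeeze_zero (fun _ => dist_nonneg) (fun p => ?_) h1
    exact (dist_triangle _ (γ x p.1) _).trans (add_le_add_left (hdist _ _ _) _)
  · have := IsIntegralCurve.eq_of_lipschitzWith hv (γ := fun t => γ x (t + s))
      (δ := γ (γ x s)) ((hγ x).comp_add s) (hγ _) (by simp [h0])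
    exact congrFun this t

end FlowExistence

/-! ### Non-degeneracy in a symplectic frame -/

section SymplecticFrame

/-- The indices `0, …, 2n` of a frame adapted to a contact form: `none` is the index `0` of the
Reeb direction, `(i, false)` and `(i, true)` are the indices `2i+1`, `2i+2` of the `i`-th symplectic
pair. -/
def frameIndex (n : ℕ) : Option (Fin n × Bool) ≃ Fin (2 * n + 1) where
  toFun
    | none => 0
    | some (i, false) => ⟨2 * (i : ℕ) + 1, by omega⟩
    | some (i, true) => ⟨2 * (i : ℕ) + 2, by omega⟩
  invFun k :=
    if h : (k : ℕ) = 0 then none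
    else some (⟨((k : ℕ) - 1) / 2, by omega⟩, decide ((k : ℕ) % 2 = 0))
  left_inv o := by
    rcases o with _ | ⟨i, _ | _⟩
    · simp
    · simp
    · simp
      ext
      simp
      omega
  right_inv k := by
    rcases Nat.even_or_odd' (k : ℕ) with ⟨c, hc | hc⟩
    · rcases Nat.eq_zero_or_pos c with rfl | hc0
      · ext; simp [hc]
      · ext; simp [hc, hc0.ne']; omega
    · ext; simp [hc]

/-- The permutation `(i, b) ↦ (τ i, s i b)` of `Fin n × Bool`: its sign is the product of the signs
of the `s i`, as `τ` acts on two copies of `Fin n`. -/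
theorem sign_pairPerm {n : ℕ} (τ : Equiv.Perm (Fin n)) (s : Fin n → Equiv.Perm Bool) :
    Equiv.Perm.sign ((Equiv.prodCongrLeft fun _ : Bool => τ) * Equiv.prodCongrRight s) =
      ∏ i, Equiv.Perm.sign (s i) := by
  rw [Equiv.Perm.sign_mul, Equiv.Perm.sign_prodCongrLeft, Equiv.Perm.sign_prodCongrRight]
  simp

/-- If the products of the frame vectors under `dα` are those of a symplectic frame, each term of
the sum that defines `α ∧ (dα)^n` is non-negative: a permutation with a non-zero term permutes the
symplectic pairs, and the signs from the flipped pairs cancel against its sign. -/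
theorem sum_perm_symplecticFrame_pos {n : ℕ} (a : Option (Fin n × Bool) → ℝ)
    (w : Option (Fin n × Bool) → Option (Fin n × Bool) → ℝ) (c : ℝ) (hc : 0 < c)
    (ha0 : 0 < a none) (ha : ∀ i, a (some i) = 0)
    (hw1 : ∀ i, w (some (i, false)) (some (i, true)) = c)
    (hw2 : ∀ i, w (some (i, true)) (some (i, false)) = -c)
    (hw0 : ∀ k l, w k l ≠ 0 → ∃ i b, k = some (i, b) ∧ l = some (i, !b)) :
    0 < ∑ σ : Equiv.Perm (Option (Fin n × Bool)), ((Equiv.Perm.sign σ : ℤ) : ℝ) * a (σ none) *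
      ∏ i : Fin n, w (σ (some (i, false))) (σ (some (i, true))) := by
  classical
  refine Finset.sum_pos' (fun σ _ => ?_) ⟨1, Finset.mem_univ _, ?_⟩
  · by_cases hσ0 : a (σ none) = 0
    · simp [hσ0]
    by_cases hσ : ∏ i : Fin n, w (σ (some (i, false))) (σ (some (i, true))) = 0
    · simp [hσ]
    have h0 : σ none = none := by
      rcases h : σ none with _ | i
      · rfl
      · exact absurd (h ▸ ha i) hσ0
    have hpair := fun i => hw0 _ _ (Finset.prod_ne_zero_iff.1 hσ i (Finset.mem_univ _))
    choose τ b h1 h2 using hpair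
    have hτ : Function.Injective τ := by
      intro i j hij
      have key : ∀ i, σ (some (i, b i)) = some (τ i, false) := fun i => by
        cases hb : b i
        · rw [h1, hb]
        · rw [h2, hb]; rfl
      have := σ.injective ((key i).trans ((congrArg (fun k => some (k, false)) hij).trans
        (key j).symm))
      simpa using congrArg (Option.map Prod.fst) this
    let τ' : Equiv.Perm (Fin n) := Equiv.ofBijective τ (Finite.injective_iff_bijective.1 hτ)
    let s : Fin n → Equiv.Perm Bool := fun i => if b i then Equiv.boolNot else 1
    have hs : σ = Equiv.optionCongr
        ((Equiv.prodCongrLeft fun _ : Bool => τ') * Equiv.prodCongrRight s) := by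
      ext1 o
      rcases o with _ | ⟨i, _ | _⟩
      · simp [h0]
      · rw [h1]
        cases hb : b i <;> simp [s, hb, τ']
      · rw [h2]
        cases hb : b i <;> simp [s, hb, τ']
    have hsign : ((Equiv.Perm.sign σ : ℤ) : ℝ) = ∏ i, ((Equiv.Perm.sign (s i) : ℤ) : ℝ) := by
      rw [hs, Equiv.optionCongr_sign, sign_pairPerm]
      push_cast
      rfl
    have hsw : ∀ i, ((Equiv.Perm.sign (s i) : ℤ) : ℝ) *
        w (σ (some (i, false))) (σ (some (i, true))) = c := by
      intro i
      rw [h1, h2]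
      cases hb : b i
      · simp [s, hb, hw1]
      · have : Equiv.Perm.sign Equiv.boolNot = -1 := by decide
        simp [s, hb, hw2, this]
    rw [h0, hsign, mul_right_comm, ← Finset.prod_mul_distrib, Finset.prod_congr rfl
      (fun i _ => hsw i)]
    simp only [Finset.prod_const]
    positivity
  · simp [hw1]
    positivity

end SymplecticFrame

section

variable {E : Type*} [NormedAddCommGroup E] [NormedSpace ℝ E]

theorem wedgeTop_pos_of_symplecticFrame {n : ℕ} {α : E → E →L[ℝ] ℝ} {x : E}
    (v : Option (Fin n × Bool) → E) {c : ℝ} (hc : 0 < c)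
    (ha0 : 0 < α x (v none)) (ha : ∀ i, α x (v (some i)) = 0)
    (hw1 : ∀ i, extD α x (v (some (i, false))) (v (some (i, true))) = c)
    (hw2 : ∀ i, extD α x (v (some (i, true))) (v (some (i, false))) = -c)
    (hw0 : ∀ k l, extD α x (v k) (v l) ≠ 0 → ∃ i b, k = some (i, b) ∧ l = some (i, !b)) :
    0 < wedgeTop n α x (fun k => v ((frameIndex n).symm k)) := by
  unfold wedgeTop
  refine mul_pos (by positivity) ?_
  have := sum_perm_symplecticFrame_pos (fun k => α x (v k)) (fun k l => extD α x (v k) (v l))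
    c hc ha0 ha hw1 hw2 hw0
  refine this.trans_eq (Fintype.sum_equiv (frameIndex n).permCongr _ _ fun σ => ?_)
  rw [Equiv.Perm.sign_permCongr]
  have e1 : ∀ i : Fin n, (⟨2 * (i : ℕ) + 1, by omega⟩ : Fin (2 * n + 1)) =
    frameIndex n (some (i, false)) := fun _ => rfl
  have e2 : ∀ i : Fin n, (⟨2 * (i : ℕ) + 2, by omega⟩ : Fin (2 * n + 1)) =
    frameIndex n (some (i, true)) := fun _ => rfl
  have e0 : (0 : Fin (2 * n + 1)) = frameIndex n none := rfl
  simp only [e0, e1, e2, Equiv.permCongr_apply, Equiv.symm_apply_apply]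

end

/-! ### The Reeb field of `e^{-η} α_st` -/

section Reeb

variable {n : ℕ}

/-- The form `∑_j dx_j ∧ dy_j` on `ℝ^{2n}`, which is `dα_st`. -/
def sympForm (v w : Plane n) : ℝ :=
  ∑ j, ((v j).1 * (w j).2 - (v j).2 * (w j).1)

theorem sympForm_single (i j : Fin n) (a b : ℝ × ℝ) :
    sympForm (Pi.single i a) (Pi.single j b) = if i = j then a.1 * b.2 - a.2 * b.1 else 0 := by
  unfold sympForm
  split_ifs with h
  · subst h
    rw [Finset.sum_eq_single i]
    · simp
    · intro k _ hk
      simp [Pi.single_eq_of_ne hk]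
    · simp
  · refine Finset.sum_eq_zero fun k _ => ?_
    by_cases hk : k = i
    · subst hk
      simp [Pi.single_eq_of_ne h]
    · simp [Pi.single_eq_of_ne hk]

theorem sympForm_swap (v w : Plane n) : sympForm w v = -sympForm v w := by
  unfold sympForm
  rw [← Finset.sum_neg_distrib]
  exact Finset.sum_congr rfl fun j _ => by ring

theorem alphaSt_apply (q v : Space n) :
    alphaSt n q v = v.2 + 1 / 2 * sympForm q.1 v.1 := by
  simp [alphaSt, sympForm, dx, dy, dz]

theorem contDiff_alphaSt : ContDiff ℝ ∞ (alphaSt n) := by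
  unfold alphaSt
  fun_prop

theorem hasFDerivAt_alphaSt_apply (q w : Space n) :
    ∃ L : Space n →L[ℝ] ℝ, HasFDerivAt (fun q => alphaSt n q w) L q ∧
      ∀ v, L v = 1 / 2 * sympForm v.1 w.1 := by
  let L : Space n →L[ℝ] ℝ :=
    (1 / 2 : ℝ) • ∑ j : Fin n, ((w.1 j).2 • dx n j - (w.1 j).1 • dy n j)
  have hL : ∀ v, L v = 1 / 2 * sympForm v.1 w.1 := fun v => by
    simp [L, sympForm, dx, dy, mul_comm]
  refine ⟨L, ?_, hL⟩
  have : (fun q => alphaSt n q w) = fun q => w.2 + L q := by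
    funext q
    rw [alphaSt_apply, hL]
  rw [this]
  exact L.hasFDerivAt.const_add _

/-- The form `e^{-η} α_st`. -/
noncomputable def expForm (η : Space n → ℝ) (q : Space n) : Space n →L[ℝ] ℝ :=
  Real.exp (-η q) • alphaSt n q

theorem contDiff_expForm {η : Space n → ℝ} (hη : ContDiff ℝ ∞ η) : ContDiff ℝ ∞ (expForm η) :=
  (Real.contDiff_exp.comp hη.neg).smul contDiff_alphaSt

theorem definesXiSt_expForm (η : Space n → ℝ) : DefinesXiSt n (expForm η) := by
  intro q
  ext v
  simp [expForm, xiSt, (Real.exp_pos _).ne']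

theorem extD_expForm {η : Space n → ℝ} (hη : ContDiff ℝ ∞ η) (q v w : Space n) :
    extD (expForm η) q v w = Real.exp (-η q) * (sympForm v.1 w.1
      - fderiv ℝ η q v * alphaSt n q w + fderiv ℝ η q w * alphaSt n q v) := by
  have hd : DifferentiableAt ℝ (expForm η) q :=
    (contDiff_expForm hη).differentiable (by simp) q
  have key : ∀ v w, fderiv ℝ (expForm η) q v w = Real.exp (-η q) *
      (1 / 2 * sympForm v.1 w.1 - fderiv ℝ η q v * alphaSt n q w) := by
    intro v w
    obtain ⟨L, hL, hLv⟩ := hasFDerivAt_alphaSt_apply q w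
    have h1 : HasFDerivAt (fun q => expForm η q w) _ q :=
      hd.hasFDerivAt.clm_apply (hasFDerivAt_const w q)
    have h2 : HasFDerivAt (fun q => expForm η q w) _ q :=
      ((hη.differentiable (by simp) q).hasFDerivAt.neg.exp).mul hL
    have := congrArg (fun D => D v) (h1.unique h2)
    simp [hLv] at this
    rw [this]
    ring
  rw [extD_eq hd, key, key, sympForm_swap v.1 w.1]
  ring

/-- The Reeb field of `e^{-η} α_st`, that is, the contact Hamiltonian vector field of `H = e^η`:
`x_j' = -H_{y_j} + x_j H_z / 2`, `y_j' = H_{x_j} + y_j H_z / 2`,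
`z' = H - ½ ∑_j (x_j H_{x_j} + y_j H_{y_j})`. -/
noncomputable def reebField (η : Space n → ℝ) (q : Space n) : Space n :=
  Real.exp (η q) •
    ((fun j => (-fderiv ℝ η q (Pi.single j (0, 1), 0) + (q.1 j).1 / 2 * fderiv ℝ η q (0, 1),
      fderiv ℝ η q (Pi.single j (1, 0), 0) + (q.1 j).2 / 2 * fderiv ℝ η q (0, 1)),
    1 - 1 / 2 * fderiv ℝ η q (q.1, 0)) : Space n)

theorem clm_space_apply (D : Space n →L[ℝ] ℝ) (v : Space n) :
    D v = ∑ j, ((v.1 j).1 * D (Pi.single j (1, 0), 0) + (v.1 j).2 * D (Pi.single j (0, 1), 0))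
      + v.2 * D (0, 1) := by
  have hv : v = ∑ j, ((v.1 j).1 • ((Pi.single j (1, 0), 0) : Space n)
      + (v.1 j).2 • ((Pi.single j (0, 1), 0) : Space n)) + v.2 • ((0, 1) : Space n) := by
    ext j
    · simp [Prod.fst_sum, Finset.sum_apply, Pi.single_apply, apply_ite Prod.fst]
    · simp [Prod.fst_sum, Finset.sum_apply, Pi.single_apply, Prod.snd_sum, apply_ite Prod.snd]
    · simp [Prod.snd_sum]
  conv_lhs => rw [hv]
  simp only [map_add, map_sum, map_smul, smul_eq_mul]

theorem isReebField_reebField {η : Space n → ℝ} (hη : ContDiff ℝ ∞ η) :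
    IsReebField (expForm η) (reebField η) := by
  intro q
  set D := fderiv ℝ η q with hD
  set a : Fin n → ℝ := fun j => D (Pi.single j (1, 0), 0) with ha
  set b : Fin n → ℝ := fun j => D (Pi.single j (0, 1), 0) with hb
  set c : ℝ := D (0, 1) with hc
  set e : ℝ := D (q.1, 0) with he
  set u : Plane n := fun j => (-b j + (q.1 j).1 / 2 * c, a j + (q.1 j).2 / 2 * c) with hu
  have hR : reebField η q = Real.exp (η q) • (u, 1 - 1 / 2 * e) := rfl
  have hexp : Real.exp (-η q) * Real.exp (η q) = 1 := by rw [← Real.exp_add]; simp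
  have he' : e = ∑ j, ((q.1 j).1 * a j + (q.1 j).2 * b j) := by
    rw [he, clm_space_apply D]
    simp [ha, hb]
  have hα : alphaSt n q (u, 1 - 1 / 2 * e) = 1 := by
    have : sympForm q.1 u = e := by
      rw [he']
      exact Finset.sum_congr rfl fun j _ => by simp only [hu]; ring
    rw [alphaSt_apply, this]
    ring
  have hDu : D (u, 1 - 1 / 2 * e) = c := by
    have h1 : ∑ j, ((u j).1 * a j + (u j).2 * b j) = 1 / 2 * c * e := by
      rw [he', Finset.mul_sum]
      exact Finset.sum_congr rfl fun j _ => by simp only [hu]; ring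
    rw [clm_space_apply D]
    change ∑ j, ((u j).1 * a j + (u j).2 * b j) + (1 - 1 / 2 * e) * c = c
    rw [h1]
    ring
  have hω : ∀ w : Space n, sympForm u w.1 = -(D w - w.2 * c) + c * (1 / 2 * sympForm q.1 w.1) := by
    intro w
    have h1 : D w - w.2 * c = ∑ j, ((w.1 j).1 * a j + (w.1 j).2 * b j) := by
      rw [clm_space_apply D w]
      simp [ha, hb, hc]
    rw [h1, ← mul_assoc, sympForm, sympForm, Finset.mul_sum, ← Finset.sum_neg_distrib,
      ← Finset.sum_add_distrib]
    exact Finset.sum_congr rfl fun j _ => by simp only [hu]; ring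
  have hsm : ∀ w : Space n, sympForm (Real.exp (η q) • u) w.1 = Real.exp (η q) * sympForm u w.1 := by
    intro w
    rw [sympForm, sympForm, Finset.mul_sum]
    exact Finset.sum_congr rfl fun j _ => by simp; ring
  constructor
  · rw [hR, map_smul, expForm]
    simp only [smul_apply, smul_eq_mul, hα, mul_one]
    rw [mul_comm, hexp]
  · intro w
    rw [extD_expForm hη, hR]
    simp only [smul_eq_mul, Prod.smul_mk, ← hD]
    rw [← smul_eq_mul (a := Real.exp (η q)) (b := 1 - 1 / 2 * e), ← Prod.smul_mk, map_smul, map_smul,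
      hα, hDu, hsm, hω, alphaSt_apply]
    simp only [smul_eq_mul]
    ring

theorem isContactForm_expForm {η : Space n → ℝ} (hη : ContDiff ℝ ∞ η) :
    IsContactForm n (expForm η) := by
  refine ⟨contDiff_expForm hη, fun q => ?_⟩
  obtain ⟨hR1, hR2⟩ := isReebField_reebField hη q
  have hanti : ∀ v w, extD (expForm η) q v w = -extD (expForm η) q w v := fun v w => by
    rw [extD_expForm hη, extD_expForm hη, sympForm_swap w.1 v.1]
    ring
  -- the lifts of the coordinate vector fields of `ℝ^{2n}` to the contact planes
  let v : Option (Fin n × Bool) → Space n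
    | none => reebField η q
    | some (j, false) => (Pi.single j (1, 0), (q.1 j).2 / 2)
    | some (j, true) => (Pi.single j (0, 1), -(q.1 j).1 / 2)
  have hsingle : ∀ (j : Fin n) (a : ℝ × ℝ), sympForm q.1 (Pi.single j a) =
      (q.1 j).1 * a.2 - (q.1 j).2 * a.1 := by
    intro j a
    rw [sympForm, Finset.sum_eq_single j]
    · simp
    · intro k _ hk
      simp [Pi.single_eq_of_ne hk]
    · simp
  have hα : ∀ i, alphaSt n q (v (some i)) = 0 := by
    rintro ⟨j, _ | _⟩ <;> simp only [v, alphaSt_apply, hsingle] <;> ring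
  have hext : ∀ i k, extD (expForm η) q (v (some i)) (v (some k)) =
      Real.exp (-η q) * sympForm (v (some i)).1 (v (some k)).1 := fun i k => by
    rw [extD_expForm hη, hα, hα]
    ring
  refine ⟨_, (wedgeTop_pos_of_symplecticFrame v (Real.exp_pos (-η q)) ?_ ?_ ?_ ?_ ?_).ne'⟩
  · simp [v, hR1]
  · intro i
    simp [expForm, hα]
  · intro i
    refine (hext (i, false) (i, true)).trans ?_
    simp [v, sympForm_single]
  · intro i
    refine (hext (i, true) (i, false)).trans ?_
    simp [v, sympForm_single]
  · rintro (_ | ⟨i, b⟩) (_ | ⟨j, b'⟩) h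
    · exact absurd (hR2 _) h
    · exact absurd (hR2 _) h
    · rw [hanti] at h
      exact absurd (by simp [v, hR2]) h
    · rw [hext] at h
      refine ⟨i, b, rfl, ?_⟩
      rcases b with _ | _ <;> rcases b' with _ | _ <;>
        simp [v, sympForm_single] at h ⊢ <;> exact h.symm

end Reeb

/-! ### The radial profile -/

section Profile

/-- The radial slope of a contact Hamiltonian built from `Ψ` attains its maximum exactly at `t = 0`.
The profile is `t ↦ t * b t` for a bump function `b` with `b 0 = 1`, decreasing in `|t|`. -/
theorem exists_profile : ∃ Ψ : ℝ → ℝ, ContDiff ℝ ∞ Ψ ∧ Ψ 0 = 0 ∧ (∀ t, deriv Ψ t ≤ 1) ∧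
    (∀ t, deriv Ψ t = 1 ↔ t = 0) ∧ ∀ t, Ψ t ≠ 0 → |t| ≤ 1 := by
  let T := Real.smoothTransition
  have hT : ContDiff ℝ ∞ T := Real.smoothTransition.contDiff
  have hd : ∀ t, HasDerivAt (fun t => t * T (1 - t ^ 2))
      (T (1 - t ^ 2) - 2 * t ^ 2 * deriv T (1 - t ^ 2)) t := by
    intro t
    have h1 : HasDerivAt (fun t : ℝ => 1 - t ^ 2) (-(2 * t)) t := by
      simpa using (hasDerivAt_pow 2 t).const_sub 1
    have h2 : HasDerivAt T (deriv T (1 - t ^ 2)) (1 - t ^ 2) :=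
      (hT.differentiable (by simp) _).hasDerivAt
    refine ((hasDerivAt_id t).mul (h2.comp t h1)).congr_deriv ?_
    simp only [id, Function.comp]
    ring
  have hle : ∀ t, T (1 - t ^ 2) - 2 * t ^ 2 * deriv T (1 - t ^ 2) ≤ T (1 - t ^ 2) := by
    intro t
    have : 0 ≤ deriv T (1 - t ^ 2) := Real.smoothTransition.monotone.deriv_nonneg
    have : 0 ≤ 2 * t ^ 2 * deriv T (1 - t ^ 2) := by positivity
    linarith
  refine ⟨fun t => t * T (1 - t ^ 2), by fun_prop, by simp, fun t => ?_, fun t => ?_,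
    fun t ht => ?_⟩
  · rw [(hd t).deriv]
    exact (hle t).trans (Real.smoothTransition.le_one _)
  · rw [(hd t).deriv]
    refine ⟨fun h => ?_, ?_⟩
    · have h1 : T (1 - t ^ 2) = 1 :=
        le_antisymm (Real.smoothTransition.le_one _) (h.ge.trans (hle t))
      have h2 := Real.smoothTransition.eq_one_iff_one_le.1 h1
      have h3 : t ^ 2 = 0 := le_antisymm (by linarith) (sq_nonneg t)
      simpa using h3
    · rintro rfl
      simp [T]
  · by_contra h
    refine ht ?_
    have h1 : 1 < t ^ 2 := by
      rw [← sq_abs]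
      nlinarith [not_le.1 h]
    have h2 : T (1 - t ^ 2) = 0 := Real.smoothTransition.zero_of_nonpos (by linarith)
    simp [h2]

end Profile

/-! ### Polar geometry of `ℝ^{2n}` -/

section Polar

variable {n : ℕ}

/-- The square `x² + y²` of the Euclidean norm on a coordinate plane. -/
def normSq (a : ℝ × ℝ) : ℝ := a.1 ^ 2 + a.2 ^ 2

theorem normSq_nonneg (a : ℝ × ℝ) : 0 ≤ normSq a := by unfold normSq; positivity

theorem normSq_smul (s : ℝ) (a : ℝ × ℝ) : normSq (s • a) = s ^ 2 * normSq a := by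
  simp [normSq]; ring

theorem contDiff_normSq : ContDiff ℝ ∞ normSq := by unfold normSq; fun_prop

theorem mem_torus_iff {p : Plane n} : p ∈ torus n ↔ ∀ j, normSq (p j) = 1 := by
  simp only [torus, Set.mem_ofPred_eq, Real.sqrt_eq_one, normSq]

variable (n) in
/-- The set `{r_j ≠ 0 for all j}`, on which all the angles are defined. -/
def polarDomain : Set (Plane n) := {p | ∀ j, 0 < normSq (p j)}

theorem isOpen_polarDomain : IsOpen (polarDomain n) := by
  simp only [polarDomain, Set.ofPred_forall]
  refine isOpen_iInter_of_finite fun j => isOpen_lt continuous_const ?_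
  exact contDiff_normSq.continuous.comp (continuous_apply j)

theorem smul_mem_polarDomain_iff {s : ℝ} (hs : 0 < s) {p : Plane n} :
    s • p ∈ polarDomain n ↔ p ∈ polarDomain n := by
  simp [polarDomain, normSq_smul, hs]

theorem torus_subset_polarDomain : torus n ⊆ polarDomain n := fun p hp j => by
  simp [mem_torus_iff.1 hp j]

/-- The retraction of `{r_j ≠ 0}` onto the torus that keeps the angles `θ_j`. -/
noncomputable def radial (p : Plane n) : Plane n := fun j => (√(normSq (p j)))⁻¹ • p j

theorem radial_mem_torus {p : Plane n} (hp : p ∈ polarDomain n) : radial p ∈ torus n := by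
  refine mem_torus_iff.2 fun j => ?_
  rw [radial, normSq_smul, inv_pow, Real.sq_sqrt (hp j).le]
  exact inv_mul_cancel₀ (hp j).ne'

theorem radial_eq_self {p : Plane n} (hp : p ∈ torus n) : radial p = p := by
  funext j
  simp [radial, mem_torus_iff.1 hp j]

theorem radial_smul {s : ℝ} (hs : 0 < s) (p : Plane n) : radial (s • p) = radial p := by
  funext j
  simp only [radial, Pi.smul_apply, normSq_smul]
  rw [Real.sqrt_mul (sq_nonneg s), Real.sqrt_sq hs.le, smul_smul, mul_inv, mul_right_comm,
    inv_mul_cancel₀ hs.ne', one_mul]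

theorem contDiffOn_radial : ContDiffOn ℝ ∞ (radial (n := n)) (polarDomain n) := by
  refine contDiffOn_pi.2 fun j p hp => ContDiffAt.contDiffWithinAt ?_
  have h1 : ContDiffAt ℝ ∞ (fun p : Plane n => p j) p := by fun_prop
  have h2 : ContDiffAt ℝ ∞ (fun p : Plane n => normSq (p j)) p :=
    contDiff_normSq.contDiffAt.comp p h1
  exact ((h2.sqrt (hp j).ne').inv (Real.sqrt_pos.2 (hp j)).ne').smul h1

/-- The homogeneous function `((∑ r_j²) / n)^{1/2}`, which is `1` on the torus. -/
noncomputable def meanRadius (p : Plane n) : ℝ := √((∑ j, normSq (p j)) / n)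

theorem meanRadius_smul {s : ℝ} (hs : 0 < s) (p : Plane n) :
    meanRadius (s • p) = s * meanRadius p := by
  simp only [meanRadius, Pi.smul_apply, normSq_smul, ← Finset.mul_sum, mul_div_assoc]
  rw [Real.sqrt_mul (sq_nonneg s), Real.sqrt_sq hs.le]

theorem meanRadius_of_mem_torus (hn : 0 < n) {p : Plane n} (hp : p ∈ torus n) :
    meanRadius p = 1 := by
  have : (n : ℝ) ≠ 0 := by exact_mod_cast hn.ne'
  simp [meanRadius, mem_torus_iff.1 hp, this]

theorem sum_normSq_pos (hn : 0 < n) {p : Plane n} (hp : p ∈ polarDomain n) :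
    0 < (∑ j, normSq (p j)) / n := by
  have hn' : (0 : ℝ) < n := by exact_mod_cast hn
  have : Nonempty (Fin n) := ⟨⟨0, hn⟩⟩
  exact div_pos (Finset.sum_pos (fun j _ => hp j) Finset.univ_nonempty) hn'

theorem meanRadius_pos (hn : 0 < n) {p : Plane n} (hp : p ∈ polarDomain n) :
    0 < meanRadius p := Real.sqrt_pos.2 (sum_normSq_pos hn hp)

/-- The projection along the rays through the origin to `{meanRadius = 1}`. -/
noncomputable def rayProj (p : Plane n) : Plane n := (meanRadius p)⁻¹ • p

theorem rayProj_smul {s : ℝ} (hs : 0 < s) (p : Plane n) : rayProj (s • p) = rayProj p := by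
  rw [rayProj, meanRadius_smul hs, smul_smul, mul_inv, mul_right_comm, inv_mul_cancel₀ hs.ne',
    one_mul, rayProj]

theorem rayProj_of_mem_torus (hn : 0 < n) {p : Plane n} (hp : p ∈ torus n) : rayProj p = p := by
  simp [rayProj, meanRadius_of_mem_torus hn hp]

theorem normSq_rayProj_le (hn : 0 < n) {p : Plane n} (hp : p ∈ polarDomain n) (j : Fin n) :
    normSq (rayProj p j) ≤ n := by
  have hn' : (0 : ℝ) < n := by exact_mod_cast hn
  have h1 : normSq (p j) ≤ ∑ j, normSq (p j) :=
    Finset.single_le_sum (fun j _ => normSq_nonneg (p j)) (Finset.mem_univ j)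
  have h2 : ∑ j, normSq (p j) = n * meanRadius p ^ 2 := by
    rw [meanRadius, Real.sq_sqrt (sum_normSq_pos hn hp).le]
    field_simp
  rw [rayProj, Pi.smul_apply, normSq_smul, inv_pow, inv_mul_le_iff₀
    (pow_pos (meanRadius_pos hn hp) 2)]
  linarith

theorem contDiffOn_rayProj (hn : 0 < n) : ContDiffOn ℝ ∞ (rayProj (n := n)) (polarDomain n) := by
  refine fun p hp => ContDiffAt.contDiffWithinAt ?_
  have h2 : ContDiffAt ℝ ∞ (fun p : Plane n => (∑ j, normSq (p j)) / n) p := by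
    refine ContDiffAt.div_const (ContDiffAt.sum fun j _ => ?_) _
    exact contDiff_normSq.contDiffAt.comp p (by fun_prop)
  exact ((h2.sqrt (sum_normSq_pos hn hp).ne').inv (meanRadius_pos hn hp).ne').smul contDiffAt_id

theorem mem_polarDomain_of_rayProj {p : Plane n} (hp : rayProj p ∈ polarDomain n) :
    p ∈ polarDomain n := by
  intro j
  have h := hp j
  rw [rayProj, Pi.smul_apply, normSq_smul] at h
  exact (pos_iff_pos_of_mul_pos h).1 (pos_of_mul_pos_left h (normSq_nonneg _))

theorem isCompact_normSq_Icc {a b : ℝ} : IsCompact {p : Plane n | ∀ j, normSq (p j) ∈ Icc a b} := by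
  refine Metric.isCompact_of_isClosed_isBounded ?_ ?_
  · simp only [Set.ofPred_forall]
    refine isClosed_iInter fun j => isClosed_Icc.preimage ?_
    exact contDiff_normSq.continuous.comp (continuous_apply j)
  · refine (Metric.isBounded_closedBall (x := 0) (r := |b| + 1)).subset fun p hp => ?_
    rw [mem_closedBall_zero_iff]
    refine (pi_norm_le_iff_of_nonneg (by positivity)).2 fun j => ?_
    have h1 := (hp j).2
    have h2 := le_abs_self b
    unfold normSq at h1
    rw [Prod.norm_def, Real.norm_eq_abs, Real.norm_eq_abs]
    refine max_le (abs_le.2 ⟨?_, ?_⟩) (abs_le.2 ⟨?_, ?_⟩) <;>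
      nlinarith [sq_nonneg (p j).1, sq_nonneg (p j).2, sq_nonneg ((p j).1 + 1),
        sq_nonneg ((p j).1 - 1), sq_nonneg ((p j).2 + 1), sq_nonneg ((p j).2 - 1)]

end Polar

/-! ### The logarithm of the contact Hamiltonian -/

section LogHamiltonian

variable {n : ℕ}

/-- The function `∑_j h_j(θ) log r_j` on `{r_j ≠ 0}`. -/
noncomputable def logRadius (h : Fin n → Plane n → ℝ) (p : Plane n) : ℝ :=
  1 / 2 * ∑ j, h j (radial p) * Real.log (normSq (p j))

variable {h : Fin n → Plane n → ℝ}

theorem contDiffOn_comp_radial (hh : ∀ j, ContDiffOn ℝ ∞ (h j) (torus n)) (j : Fin n) :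
    ContDiffOn ℝ ∞ (fun p => h j (radial p)) (polarDomain n) :=
  (hh j).comp contDiffOn_radial fun _ hp => radial_mem_torus hp

theorem contDiffOn_logRadius (hh : ∀ j, ContDiffOn ℝ ∞ (h j) (torus n)) :
    ContDiffOn ℝ ∞ (logRadius h) (polarDomain n) := by
  unfold logRadius
  refine contDiffOn_const.mul (ContDiffOn.sum fun j _ => (contDiffOn_comp_radial hh j).mul ?_)
  refine ContDiffOn.log (fun p _ => ContDiffAt.contDiffWithinAt ?_) fun p hp => (hp j).ne'
  exact contDiff_normSq.contDiffAt.comp p (by fun_prop)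

theorem logRadius_smul (hsum : ∀ p ∈ torus n, ∑ j, h j p = 2) {s : ℝ} (hs : 0 < s) {p : Plane n}
    (hp : p ∈ polarDomain n) : logRadius h (s • p) = logRadius h p + 2 * Real.log s := by
  have h1 : ∀ j, Real.log (normSq ((s • p) j)) = Real.log (normSq (p j)) + 2 * Real.log s := by
    intro j
    rw [Pi.smul_apply, normSq_smul, Real.log_mul (by positivity) (hp j).ne', Real.log_pow]
    push_cast
    ring
  simp only [logRadius, radial_smul hs, h1, mul_add, Finset.sum_add_distrib, ← Finset.sum_mul]
  rw [hsum _ (radial_mem_torus hp)]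
  ring

theorem logRadius_of_mem_torus {p : Plane n} (hp : p ∈ torus n) : logRadius h p = 0 := by
  simp [logRadius, mem_torus_iff.1 hp]

theorem fderiv_logRadius (hh : ∀ j, ContDiffOn ℝ ∞ (h j) (torus n)) {p : Plane n}
    (hp : p ∈ torus n) (v : Plane n) :
    fderiv ℝ (logRadius h) p v = ∑ j, h j p * ((p j).1 * (v j).1 + (p j).2 * (v j).2) := by
  have hpU := torus_subset_polarDomain hp
  have hq : ∀ j, HasFDerivAt (fun p : Plane n => normSq (p j))
      ((2 * (p j).1) • ((ContinuousLinearMap.fst ℝ ℝ ℝ).comp (ContinuousLinearMap.proj j)) +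
        (2 * (p j).2) • ((ContinuousLinearMap.snd ℝ ℝ ℝ).comp (ContinuousLinearMap.proj j))) p := by
    intro j
    have h1 : HasFDerivAt (fun p : Plane n => (p j).1)
      ((ContinuousLinearMap.fst ℝ ℝ ℝ).comp (ContinuousLinearMap.proj j)) p :=
      ((ContinuousLinearMap.fst ℝ ℝ ℝ).comp
        (ContinuousLinearMap.proj (R := ℝ) (φ := fun _ : Fin n => ℝ × ℝ) j)).hasFDerivAt
    have h2 : HasFDerivAt (fun p : Plane n => (p j).2)
      ((ContinuousLinearMap.snd ℝ ℝ ℝ).comp (ContinuousLinearMap.proj j)) p :=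
      ((ContinuousLinearMap.snd ℝ ℝ ℝ).comp
        (ContinuousLinearMap.proj (R := ℝ) (φ := fun _ : Fin n => ℝ × ℝ) j)).hasFDerivAt
    simpa [normSq] using (h1.pow 2).fun_add (h2.pow 2)
  have hg : ∀ j, DifferentiableAt ℝ (fun p => h j (radial p)) p := fun j =>
    ((contDiffOn_comp_radial hh j).contDiffAt (isOpen_polarDomain.mem_nhds hpU)).differentiableAt
      (by simp)
  have hd : HasFDerivAt (logRadius h) _ p :=
    (HasFDerivAt.fun_sum fun j (_ : j ∈ Finset.univ) =>
      (hg j).hasFDerivAt.mul ((hq j).log (hpU j).ne')).const_mul (1 / 2)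
  rw [hd.fderiv]
  simp only [mem_torus_iff.1 hp, radial_eq_self hp, Real.log_one]
  simp [Finset.mul_sum]
  exact Finset.sum_congr rfl fun j _ => by ring

/-- The logarithm of a contact Hamiltonian whose Reeb field is tangent to the torus along
`A × {0}` and strictly increases `z` elsewhere. It has the form `c * Ψ(ℓ)`, where the cutoff `c` is
constant on the rays through the origin of `ℝ^{2n}`, while `ℓ = logRadius h` has slope `2` along
them, so that only `Ψ'(ℓ)` enters the radial derivative. -/
theorem exists_logHamiltonian (hn : 0 < n) (hh : ∀ j, ContDiffOn ℝ ∞ (h j) (torus n))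
    (hsum : ∀ p ∈ torus n, ∑ j, h j p = 2) {A : Set (Plane n)} (hAT : A ⊆ torus n)
    (hA : IsCompact A) :
    ∃ η : Space n → ℝ, ContDiff ℝ ∞ η ∧ HasCompactSupport η ∧
      (∀ q, fderiv ℝ η q (q.1, 0) ≤ 2) ∧
      (∀ q, fderiv ℝ η q (q.1, 0) = 2 ↔ q ∈ A ×ˢ ({0} : Set ℝ)) ∧
      ∀ p ∈ A, η (p, 0) = 0 ∧ ∀ v : Space n, fderiv ℝ η (p, 0) v =
        ∑ j, h j p * ((p j).1 * (v.1 j).1 + (p j).2 * (v.1 j).2) := by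
  obtain ⟨Ψ, hΨ, hΨ0, hΨ1, hΨeq, hΨsupp⟩ := exists_profile
  have hΨd : ∀ t, HasDerivAt Ψ (deriv Ψ t) t := fun t => (hΨ.differentiable (by simp) t).hasDerivAt
  let O : Set (Space n) := {q | (∀ j, 1 / 4 < normSq (q.1 j)) ∧ |q.2| < 1}
  have hO : IsOpen O := by
    have h1 : IsOpen {q : Space n | ∀ j, 1 / 4 < normSq (q.1 j)} := by
      simp only [Set.ofPred_forall]
      refine isOpen_iInter_of_finite fun j => isOpen_lt continuous_const ?_
      exact contDiff_normSq.continuous.comp ((continuous_apply j).comp continuous_fst)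
    exact h1.inter (isOpen_lt (continuous_abs.comp continuous_snd) continuous_const)
  have hAO : A ×ˢ ({0} : Set ℝ) ⊆ O := by
    rintro ⟨p, z⟩ ⟨hp, hz⟩
    have hz' : z = 0 := hz
    refine ⟨fun j => ?_, by simp [hz']⟩
    rw [mem_torus_iff.1 (hAT hp) j]
    norm_num
  obtain ⟨c, hc, hcr, hc0, hc1⟩ := exists_contMDiff_zero_iff_one_iff_of_isClosed
    (n := ⊤) (modelWithCornersSelf ℝ (Space n)) hO.isClosed_compl
    (hA.prod isCompact_singleton).isClosed (Set.disjoint_compl_left_iff_subset.2 hAO)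
  rw [contMDiff_iff_contDiff] at hc
  have hc01 : ∀ q, 0 ≤ c q ∧ c q ≤ 1 := fun q => hcr (mem_range_self q)
  have hcO : ∀ q, c q ≠ 0 → q ∈ O := fun q hq => by
    by_contra h
    exact hq ((hc0 q).1 h)
  have hOU : ∀ p z, (rayProj p, z) ∈ O → p ∈ polarDomain n := fun p z h =>
    mem_polarDomain_of_rayProj fun j => lt_trans (by norm_num) (h.1 j)
  set ℓ := logRadius h with hℓ
  let η : Space n → ℝ := fun q => c (rayProj q.1, q.2) * Ψ (ℓ q.1)
  -- off the polar domain the cutoff vanishes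
  have hη0 : ∀ p z, p ∉ polarDomain n → η (p, z) = 0 := by
    intro p z hp
    have : c (rayProj p, z) = 0 := by
      by_contra h
      exact hp (hOU p z (hcO _ h))
    simp [η, this]
  have hηU : ∀ q : Space n, q.1 ∈ polarDomain n → ContDiffAt ℝ ∞ η q := by
    intro q hq
    have hnhds := isOpen_polarDomain.mem_nhds hq
    have h1 : ContDiffAt ℝ ∞ (fun q : Space n => (rayProj q.1, q.2)) q :=
      (((contDiffOn_rayProj hn).contDiffAt hnhds).comp q contDiffAt_fst).prodMk contDiffAt_snd
    have h2 : ContDiffAt ℝ ∞ (fun q : Space n => ℓ q.1) q :=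
      ((contDiffOn_logRadius hh).contDiffAt hnhds).comp q contDiffAt_fst
    exact (hc.contDiffAt.comp q h1).mul (hΨ.contDiffAt.comp q h2)
  -- the support lies in a bounded part of the cone over a compact subset of the polar domain
  obtain ⟨K, hK, hKU, hηK⟩ : ∃ K : Set (Space n), IsCompact K ∧
      (∀ q ∈ K, q.1 ∈ polarDomain n) ∧ ∀ q, η q ≠ 0 → q ∈ K := by
    let S : Set (Plane n) := {p | ∀ j, normSq (p j) ∈ Icc (1 / 4 : ℝ) n}
    have hS : IsCompact S := isCompact_normSq_Icc
    have hSU : S ⊆ polarDomain n := fun p hp j => lt_of_lt_of_le (by norm_num) (hp j).1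
    obtain ⟨C, hC⟩ := hS.exists_bound_of_continuousOn
      ((contDiffOn_logRadius hh).continuousOn.mono hSU)
    let B : ℝ := (C + 1) / 2
    refine ⟨(fun x : ℝ × Plane n × ℝ => (x.1 • x.2.1, x.2.2)) ''
      (Icc (Real.exp (-B)) (Real.exp B) ×ˢ S ×ˢ Icc (-1) 1), ?_, ?_, ?_⟩
    · exact (isCompact_Icc.prod (hS.prod isCompact_Icc)).image (by fun_prop)
    · rintro _ ⟨⟨s, m, z⟩, ⟨hs, hm, -⟩, rfl⟩
      exact (smul_mem_polarDomain_iff (lt_of_lt_of_le (Real.exp_pos _) hs.1)).2 (hSU hm)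
    · rintro ⟨p, z⟩ hq
      have hO' := hcO _ (left_ne_zero_of_mul hq)
      have hp := hOU p z hO'
      have hN := meanRadius_pos hn hp
      have hmS : rayProj p ∈ S := fun j => ⟨(hO'.1 j).le, normSq_rayProj_le hn hp j⟩
      have hpm : meanRadius p • rayProj p = p := by
        rw [rayProj, smul_smul, mul_inv_cancel₀ hN.ne', one_smul]
      have h1 : ℓ p = ℓ (rayProj p) + 2 * Real.log (meanRadius p) := by
        conv_lhs => rw [← hpm]
        exact logRadius_smul hsum hN (hSU hmS)
      have h2 : |ℓ p| ≤ 1 := hΨsupp _ (right_ne_zero_of_mul hq)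
      have h3 : |ℓ (rayProj p)| ≤ C := hC _ hmS
      rw [abs_le] at h2 h3
      have h4 := abs_lt.1 hO'.2
      refine ⟨(meanRadius p, rayProj p, z), ⟨⟨?_, ?_⟩, hmS, h4.1.le, h4.2.le⟩, ?_⟩
      · rw [← Real.le_log_iff_exp_le hN]
        simp only [B]
        linarith
      · rw [← Real.log_le_iff_le_exp hN]
        simp only [B]
        linarith
      · simp [hpm]
  have hts : tsupport η ⊆ K := closure_minimal (fun q hq => hηK q hq) hK.isClosed
  have hηs : ContDiff ℝ ∞ η := by
    rw [contDiff_iff_contDiffAt]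
    intro q
    by_cases hq : q ∈ tsupport η
    · exact hηU q (hKU q (hts hq))
    · exact contDiffAt_const.congr_of_eventuallyEq (notMem_tsupport_iff_eventuallyEq.1 hq)
  have hηd : ∀ q, HasFDerivAt η (fderiv ℝ η q) q := fun q =>
    (hηs.differentiable (by simp) q).hasFDerivAt
  have hcurve : ∀ q : Space n,
      HasDerivAt (fun s : ℝ => η (s • q.1, q.2)) (fderiv ℝ η q (q.1, 0)) 1 := by
    intro q
    have h1 : HasDerivAt (fun s : ℝ => ((s • q.1, q.2) : Space n)) (q.1, 0) 1 := by
      simpa using ((hasDerivAt_id (1 : ℝ)).smul_const q.1).prodMk (hasDerivAt_const 1 q.2)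
    have h2 := hηd q
    rw [show q = ((1 : ℝ) • q.1, q.2) by simp] at h2
    simpa [Function.comp_def] using h2.comp_hasDerivAt 1 h1
  have hE : ∀ q : Space n, q.1 ∈ polarDomain n →
      fderiv ℝ η q (q.1, 0) = 2 * (c (rayProj q.1, q.2) * deriv Ψ (ℓ q.1)) := by
    intro q hq
    have h1 : HasDerivAt (fun s : ℝ => ℓ q.1 + 2 * Real.log s) 2 1 := by
      simpa using ((Real.hasDerivAt_log one_ne_zero).const_mul 2).const_add (ℓ q.1)
    have h2 : HasDerivAt (fun s : ℝ => c (rayProj q.1, q.2) * Ψ (ℓ q.1 + 2 * Real.log s))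
        (c (rayProj q.1, q.2) * (deriv Ψ (ℓ q.1) * 2)) 1 := by
      have h3 := hΨd (ℓ q.1 + 2 * Real.log 1)
      have h4 := (h3.comp 1 h1).const_mul (c (rayProj q.1, q.2))
      simpa using h4
    have h5 := h2.congr_of_eventuallyEq (f₁ := fun s : ℝ => η (s • q.1, q.2)) (by
      filter_upwards [lt_mem_nhds (zero_lt_one' ℝ)] with s hs
      simp only [η, rayProj_smul hs, hℓ, logRadius_smul hsum hs hq])
    rw [(hcurve q).unique h5]
    ring
  have hE0 : ∀ q : Space n, q.1 ∉ polarDomain n → fderiv ℝ η q (q.1, 0) = 0 := by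
    intro q hq
    refine (hcurve q).unique ((hasDerivAt_const (1 : ℝ) (0 : ℝ)).congr_of_eventuallyEq ?_)
    filter_upwards [lt_mem_nhds (zero_lt_one' ℝ)] with s hs
    exact hη0 _ _ fun h => hq ((smul_mem_polarDomain_iff hs).1 h)
  refine ⟨η, hηs, HasCompactSupport.of_support_subset_isCompact hK (fun q hq => hηK q hq), ?_, ?_,
    ?_⟩
  · intro q
    by_cases hq : q.1 ∈ polarDomain n
    · rw [hE q hq]
      nlinarith [hc01 (rayProj q.1, q.2), hΨ1 (ℓ q.1)]
    · rw [hE0 q hq]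
      norm_num
  · rintro ⟨p, z⟩
    by_cases hq : p ∈ polarDomain n
    · rw [hE (p, z) hq]
      constructor
      · intro h
        have hc' := hc01 (rayProj p, z)
        have hΨ' := hΨ1 (ℓ p)
        have h1 : c (rayProj p, z) * deriv Ψ (ℓ p) = 1 := by
          have : (2 : ℝ) * (c (rayProj p, z) * deriv Ψ (ℓ p)) = 2 := h
          linarith
        have h2 : c (rayProj p, z) = 1 := by nlinarith
        have h3 : deriv Ψ (ℓ p) = 1 := by rwa [h2, one_mul] at h1
        obtain ⟨hA', hz⟩ := (hc1 _).2 h2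
        have hT : rayProj p ∈ torus n := hAT hA'
        have hN := meanRadius_pos hn hq
        have hpm : meanRadius p • rayProj p = p := by
          rw [rayProj, smul_smul, mul_inv_cancel₀ hN.ne', one_smul]
        have h4 := logRadius_smul hsum hN (torus_subset_polarDomain hT)
        rw [hpm, logRadius_of_mem_torus hT, ← hℓ, (hΨeq _).1 h3] at h4
        have h5 : meanRadius p = 1 := Real.eq_one_of_pos_of_log_eq_zero hN (by linarith)
        rw [h5, one_smul] at hpm
        exact ⟨hpm ▸ hA', hz⟩
      · rintro ⟨hpA, hz⟩
        have hT := hAT hpA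
        have h1 : c (p, z) = 1 := (hc1 _).1 ⟨hpA, hz⟩
        have h2 : ℓ p = 0 := logRadius_of_mem_torus hT
        have h3 : deriv Ψ 0 = 1 := (hΨeq 0).2 rfl
        simp [rayProj_of_mem_torus hn hT, h1, h2, h3]
    · rw [hE0 (p, z) hq]
      refine ⟨fun h => by norm_num at h, fun h => ?_⟩
      exact absurd (torus_subset_polarDomain (hAT h.1)) hq
  · intro p hp
    have hT := hAT hp
    have hpU := torus_subset_polarDomain hT
    have hcp : c (rayProj p, 0) = 1 := by
      rw [rayProj_of_mem_torus hn hT]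
      exact (hc1 _).1 ⟨hp, rfl⟩
    refine ⟨by simp [η, hℓ, logRadius_of_mem_torus hT, hΨ0], fun v => ?_⟩
    have hnhds := isOpen_polarDomain.mem_nhds hpU
    have h1 : ContDiffAt ℝ ∞ (fun q : Space n => c (rayProj q.1, q.2)) (p, 0) :=
      hc.contDiffAt.comp (p, 0) ((((contDiffOn_rayProj hn).contDiffAt hnhds).comp (p, 0)
        contDiffAt_fst).prodMk contDiffAt_snd)
    have h2 : HasFDerivAt ℓ (fderiv ℝ ℓ p) p :=
      (((contDiffOn_logRadius hh).contDiffAt hnhds).differentiableAt (by simp)).hasFDerivAt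
    have h3 : HasFDerivAt (fun q : Space n => ℓ q.1)
        ((fderiv ℝ ℓ p).comp (ContinuousLinearMap.fst ℝ (Plane n) ℝ)) (p, 0) :=
      HasFDerivAt.comp (f := (Prod.fst : Space n → Plane n)) (p, (0 : ℝ)) h2 hasFDerivAt_fst
    have h4 := (hΨd (ℓ p)).comp_hasFDerivAt (p, (0 : ℝ)) h3
    have h5 : HasFDerivAt η _ (p, 0) := (h1.differentiableAt (by simp)).hasFDerivAt.mul h4
    rw [h5.fderiv]
    have h6 : deriv Ψ 0 = 1 := (hΨeq 0).2 rfl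
    simp [logRadius_of_mem_torus hT, hΨ0, hcp, h6, hℓ, fderiv_logRadius hh hT]

end LogHamiltonian

/-! ### Invariant subsets of the torus -/

section TorusCurves

variable {n : ℕ}

theorem isCompact_torus : IsCompact (torus n) := by
  have : torus n = {p | ∀ j, normSq (p j) ∈ Icc (1 : ℝ) 1} := by
    ext p
    simp [mem_torus_iff]
  rw [this]
  exact isCompact_normSq_Icc

variable (n) in
theorem exists_torus_cutoff : ∃ χ : Plane n → ℝ, ContDiff ℝ ∞ χ ∧ HasCompactSupport χ ∧
    tsupport χ ⊆ polarDomain n ∧ ∀ p ∈ torus n, χ p = 1 := by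
  let K : Set (Plane n) := {p | ∀ j, normSq (p j) ∈ Icc (1 / 4 : ℝ) 4}
  let O : Set (Plane n) := {p | ∀ j, normSq (p j) ∈ Ioo (1 / 4 : ℝ) 4}
  have hK : IsCompact K := isCompact_normSq_Icc
  have hO : IsOpen O := by
    simp only [O, Set.ofPred_forall]
    refine isOpen_iInter_of_finite fun j => isOpen_Ioo.preimage ?_
    exact contDiff_normSq.continuous.comp (continuous_apply j)
  have hTO : torus n ⊆ O := fun p hp j => by
    rw [mem_torus_iff.1 hp j]
    norm_num
  obtain ⟨χ, hχ, -, hχ0, hχ1⟩ := exists_contMDiff_zero_iff_one_iff_of_isClosed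
    (n := ⊤) (modelWithCornersSelf ℝ (Plane n)) hO.isClosed_compl
    isCompact_torus.isClosed (Set.disjoint_compl_left_iff_subset.2 hTO)
  have hsupp : Function.support χ ⊆ K := fun p hp j => by
    have : p ∈ O := by
      by_contra h
      exact hp ((hχ0 p).1 h)
    exact Ioo_subset_Icc_self (this j)
  refine ⟨χ, contMDiff_iff_contDiff.1 hχ, HasCompactSupport.of_support_subset_isCompact hK hsupp,
    (closure_minimal hsupp hK.isClosed).trans fun p hp j => ?_, fun p hp => (hχ1 p).1 hp⟩
  exact lt_of_lt_of_le (by norm_num) (hp j).1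

/-- A smooth map on the torus, extended to `ℝ^{2n}` by means of the radial retraction and a cutoff,
is bounded and Lipschitz. -/
theorem exists_bound_lipschitzWith_smul_comp_radial {F : Type*} [NormedAddCommGroup F]
    [NormedSpace ℝ F] {χ : Plane n → ℝ} (hχ : ContDiff ℝ ∞ χ) (hχc : HasCompactSupport χ)
    (hχU : tsupport χ ⊆ polarDomain n) {g : Plane n → F} (hg : ContDiffOn ℝ ∞ g (torus n)) :
    ∃ (C : ℝ) (K : NNReal), (∀ p, ‖χ p • g (radial p)‖ ≤ C) ∧
      LipschitzWith K fun p => χ p • g (radial p) := by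
  have hc : HasCompactSupport fun p => χ p • g (radial p) := hχc.smul_right
  have hs : ContDiff ℝ ∞ fun p => χ p • g (radial p) := by
    rw [contDiff_iff_contDiffAt]
    intro p
    by_cases hp : p ∈ tsupport χ
    · have h1 : ContDiffOn ℝ ∞ (fun p => g (radial p)) (polarDomain n) :=
        hg.comp contDiffOn_radial fun _ hp => radial_mem_torus hp
      exact hχ.contDiffAt.smul (h1.contDiffAt (isOpen_polarDomain.mem_nhds (hχU hp)))
    · refine contDiffAt_const (c := 0) |>.congr_of_eventuallyEq ?_
      filter_upwards [notMem_tsupport_iff_eventuallyEq.1 hp] with y hy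
      simp [hy]
  obtain ⟨C, hC⟩ := hc.exists_bound_of_continuous hs.continuous
  obtain ⟨K, hK⟩ := ContDiff.lipschitzWith_of_hasCompactSupport hc hs (by simp)
  exact ⟨C, K, hC, hK⟩

/-- A smooth tangent vector field on the torus is complete. -/
theorem exists_isIntegralCurve_torus {V : Plane n → Plane n} (hV : IsTorusField n V)
    {a : Plane n} (ha : a ∈ torus n) :
    ∃ γ : ℝ → Plane n, γ 0 = a ∧ (∀ t, γ t ∈ torus n) ∧ IsIntegralCurve γ fun _ => V := by
  obtain ⟨χ, hχ, hχc, hχU, hχ1⟩ := exists_torus_cutoff n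
  obtain ⟨C, K, hC, hK⟩ := exists_bound_lipschitzWith_smul_comp_radial hχ hχc hχU hV.1
  obtain ⟨γ, hγ0, hγ⟩ := exists_isIntegralCurve_of_lipschitzWith hK hC a
  -- the extended field is tangent to all the tori `{r_j = const}`
  have horth : ∀ (p : Plane n) (j : Fin n), (p j).1 * ((χ p • V (radial p)) j).1 +
      (p j).2 * ((χ p • V (radial p)) j).2 = 0 := by
    intro p j
    by_cases hp : p ∈ polarDomain n
    · have h1 := hV.2 _ (radial_mem_torus hp) j
      have h2 : p j = √(normSq (p j)) • radial p j := by
        rw [radial, smul_smul, mul_inv_cancel₀ (Real.sqrt_pos.2 (hp j)).ne', one_smul]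
      have h3 : (p j).1 = √(normSq (p j)) * (radial p j).1 := congrArg Prod.fst h2
      have h4 : (p j).2 = √(normSq (p j)) * (radial p j).2 := congrArg Prod.snd h2
      simp only [Pi.smul_apply, Prod.smul_fst, Prod.smul_snd, smul_eq_mul]
      rw [h3, h4]
      linear_combination √(normSq (p j)) * χ p * h1
    · have : χ p = 0 := image_eq_zero_of_notMem_tsupport fun h => hp (hχU h)
      simp [this]
  have hT : ∀ t, γ t ∈ torus n := by
    intro t
    refine mem_torus_iff.2 fun j => ?_
    have hd : ∀ s, HasDerivAt (fun s => normSq (γ s j)) 0 s := by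
      intro s
      have h1 := hasDerivAt_pi.1 (hγ s) j
      have h2 : HasDerivAt (fun s => (γ s j).1) _ s :=
        (ContinuousLinearMap.fst ℝ ℝ ℝ).hasFDerivAt.comp_hasDerivAt s h1
      have h3 : HasDerivAt (fun s => (γ s j).2) _ s :=
        (ContinuousLinearMap.snd ℝ ℝ ℝ).hasFDerivAt.comp_hasDerivAt s h1
      refine ((h2.pow 2).fun_add (h3.pow 2)).congr_deriv ?_
      have := horth (γ s) j
      simp only [Pi.smul_apply, Prod.smul_fst, Prod.smul_snd, smul_eq_mul] at this
      simp only [Pi.smul_apply, Prod.smul_fst, Prod.smul_snd, smul_eq_mul,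
        ContinuousLinearMap.coe_fst', ContinuousLinearMap.coe_snd']
      norm_num
      linear_combination 2 * this
    have := is_const_of_deriv_eq_zero (fun s => (hd s).differentiableAt) (fun s => (hd s).deriv) t 0
    rw [this, hγ0]
    exact mem_torus_iff.1 ha j
  refine ⟨γ, hγ0, hT, fun t => ?_⟩
  simpa [hχ1 _ (hT t), radial_eq_self (hT t)] using hγ t

/-- Integral curves of `f V` are time changes of those of `V`, so they stay in `A` as well. -/
theorem exists_isIntegralCurve_smul {V : Plane n → Plane n} (hV : IsTorusField n V)
    {A : Set (Plane n)} (hAT : A ⊆ torus n) (hAinv : IsInvariantIn n V A) {f : Plane n → ℝ}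
    (hf : ContDiffOn ℝ ∞ f (torus n)) {a : Plane n} (ha : a ∈ A) :
    ∃ β : ℝ → Plane n, β 0 = a ∧ (∀ t, β t ∈ A) ∧ IsIntegralCurve β fun _ p => f p • V p := by
  obtain ⟨γ, hγ0, hγT, hγ⟩ := exists_isIntegralCurve_torus hV (hAT ha)
  have hγA := hAinv γ hγT hγ (hγ0 ▸ ha)
  obtain ⟨χ, hχ, hχc, hχU, hχ1⟩ := exists_torus_cutoff n
  obtain ⟨C, K, hC, hK⟩ := exists_bound_lipschitzWith_smul_comp_radial hχ hχc hχU hf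
  obtain ⟨C', K', hC', hK'⟩ := exists_bound_lipschitzWith_smul_comp_radial hχ hχc hχU hV.1
  have hext : ∀ t, χ (γ t) • f (radial (γ t)) = f (γ t) := fun t => by
    rw [hχ1 _ (hγT t), one_smul, radial_eq_self (hγT t)]
  have hγL : LipschitzWith C'.toNNReal γ := by
    refine lipschitzWith_of_nnnorm_deriv_le (fun t => (hγ t).differentiableAt) fun t => ?_
    rw [(hγ t).deriv, ← NNReal.coe_le_coe, coe_nnnorm]
    have := hC' (γ t)
    rw [hχ1 _ (hγT t), one_smul, radial_eq_self (hγT t)] at this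
    exact this.trans (Real.le_coe_toNNReal C')
  have hfL : LipschitzWith (K * C'.toNNReal) fun t => f (γ t) := by
    simpa only [Function.comp_def, hext] using hK.comp hγL
  obtain ⟨τ, hτ0, hτ⟩ := exists_isIntegralCurve_of_lipschitzWith hfL
    (C := C) (fun t => hext t ▸ hC (γ t)) 0
  exact ⟨fun t => γ (τ t), by simp [hτ0, hγ0], fun t => hγA _, fun t => (hγ (τ t)).scomp t (hτ t)⟩

end TorusCurves

/-! ### Flows that increase the height off an invariant set -/

section HeightDynamics

/-- A quantity that increases at a positive rate along a bounded curve tends to infinity if the rate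
is a positive continuous function on a closed set containing the curve. -/
theorem tendsto_atTop_of_isBounded {E : Type*} [NormedAddCommGroup E] [ProperSpace E]
    {F : E → ℝ} (hF : Continuous F) {γ : ℝ → E} {g : ℝ → ℝ}
    (hg : ∀ t, HasDerivAt g (F (γ t)) t) {D : Set E} (hD : IsClosed D) (hFD : ∀ x ∈ D, 0 < F x)
    (hγ : ∀ t, 0 ≤ t → γ t ∈ D) (hb : Bornology.IsBounded (γ '' Ici 0)) :
    Tendsto g atTop atTop := by
  have hsub : closure (γ '' Ici 0) ⊆ D := closure_minimal (by
    rintro _ ⟨t, ht, rfl⟩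
    exact hγ t ht) hD
  have hmem : ∀ t, 0 ≤ t → γ t ∈ closure (γ '' Ici 0) := fun t ht => subset_closure ⟨t, ht, rfl⟩
  obtain ⟨x, hx, hmin⟩ := hb.isCompact_closure.exists_isMinOn ⟨_, hmem 0 le_rfl⟩ hF.continuousOn
  have hx0 : 0 < F x := hFD x (hsub hx)
  have hlow : ∀ t, 0 ≤ t → g 0 + F x * t ≤ g t := by
    intro t ht
    have := (convex_Ici (0 : ℝ)).mul_sub_le_image_sub_of_le_deriv (f := g) (C := F x)
      (fun s _ => (hg s).continuousAt.continuousWithinAt)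
      (fun s _ => (hg s).differentiableAt.differentiableWithinAt) (fun s hs => by
        rw [(hg s).deriv]
        exact hmin (hmem s (interior_subset hs))) 0 self_mem_Ici t ht ht
    linarith
  refine tendsto_atTop_mono' _ ((eventually_ge_atTop 0).mono hlow) ?_
  exact tendsto_atTop_add_const_left _ _ (tendsto_id.const_mul_atTop hx0)

variable {n : ℕ} {R : Space n → Space n} {φ : Flow ℝ (Space n)} {S : Set (Space n)}

theorem hasDerivAt_height (hφ : IsFlowOf φ R) (q : Space n) (t : ℝ) :
    HasDerivAt (fun t => (φ t q).2) (R (φ t q)).2 t :=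
  (ContinuousLinearMap.snd ℝ (Plane n) ℝ).hasFDerivAt.comp_hasDerivAt t (hφ q t)

theorem monotone_height (hφ : IsFlowOf φ R) (hR : ∀ q, 0 ≤ (R q).2) (q : Space n) :
    Monotone fun t => (φ t q).2 :=
  monotone_of_deriv_nonneg (fun t => (hasDerivAt_height hφ q t).differentiableAt) fun t => by
    rw [(hasDerivAt_height hφ q t).deriv]
    exact hR _

theorem not_isBounded_forward (hφ : IsFlowOf φ R) (hRc : Continuous R) (hR : ∀ q, 0 ≤ (R q).2)
    (hR0 : ∀ q, (R q).2 = 0 → q ∈ S) (hS : ∀ q ∈ S, q.2 = 0) {q : Space n} (hq : 0 < q.2) :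
    ¬ Bornology.IsBounded ((fun t => φ t q) '' Ici 0) := by
  intro hb
  have hlim := tendsto_atTop_of_isBounded (F := fun q => (R q).2) (by fun_prop)
    (γ := fun t => φ t q) (hasDerivAt_height hφ q) (D := {x | q.2 ≤ x.2})
    (isClosed_le continuous_const continuous_snd)
    (fun x hx => (hR x).lt_of_ne fun h => (hq.trans_le hx).ne' (hS x (hR0 x h.symm)))
    (fun t ht => by simpa using monotone_height hφ hR q ht) hb
  obtain ⟨C, hC⟩ := hb.exists_norm_le
  obtain ⟨t, ht, ht0⟩ := ((hlim.eventually_gt_atTop C).and (eventually_ge_atTop 0)).exists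
  exact absurd ((le_abs_self _).trans ((norm_snd_le _).trans (hC _ ⟨t, ht0, rfl⟩))) (not_le.2 ht)

theorem not_isBounded_backward (hφ : IsFlowOf φ R) (hRc : Continuous R) (hR : ∀ q, 0 ≤ (R q).2)
    (hR0 : ∀ q, (R q).2 = 0 → q ∈ S) (hS : ∀ q ∈ S, q.2 = 0) {q : Space n} (hq : q.2 < 0) :
    ¬ Bornology.IsBounded ((fun t => φ t q) '' Iic 0) := by
  intro hb
  have hlim := tendsto_atTop_of_isBounded (F := fun q => (R q).2) (by fun_prop)
    (γ := fun t => φ (-t) q) (g := fun t => -(φ (-t) q).2)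
    (fun t => by
      simpa [Function.comp_def] using
        ((hasDerivAt_height hφ q (-t)).comp t (hasDerivAt_neg t)).fun_neg)
    (D := {x | x.2 ≤ q.2}) (isClosed_le continuous_snd continuous_const)
    (fun x hx => (hR x).lt_of_ne fun h => (lt_of_le_of_lt hx hq).ne (hS x (hR0 x h.symm)))
    (fun t ht => by simpa using monotone_height hφ hR q (neg_nonpos.2 ht))
    (hb.subset (by
      rintro _ ⟨t, ht, rfl⟩
      exact ⟨-t, neg_nonpos.2 (mem_Ici.1 ht), rfl⟩))
  obtain ⟨C, hC⟩ := hb.exists_norm_le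
  obtain ⟨t, ht, ht0⟩ := ((hlim.eventually_gt_atTop C).and (eventually_ge_atTop 0)).exists
  exact absurd ((neg_le_abs _).trans ((norm_snd_le _).trans
    (hC _ ⟨-t, neg_nonpos.2 ht0, rfl⟩))) (not_le.2 ht)

/-- Every orbit outside the zero set `S` of the vertical component is unbounded. -/
theorem not_isBounded_orbit (hφ : IsFlowOf φ R) (hRc : Continuous R) (hR : ∀ q, 0 ≤ (R q).2)
    (hR0 : ∀ q, (R q).2 = 0 → q ∈ S) (hS : ∀ q ∈ S, q.2 = 0) (hSφ : IsInvariant φ S)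
    {q : Space n} (hq : q ∉ S) : ¬ Bornology.IsBounded (φ.orbit q) := by
  rw [Flow.orbit_eq_range]
  intro hb
  rcases lt_trichotomy q.2 0 with h | h | h
  · exact not_isBounded_backward hφ hRc hR hR0 hS h (hb.subset (image_subset_range _ _))
  · -- after some time the orbit has positive height
    have hout : ∀ t, φ t q ∉ S := fun t ht => hq (by
      have := hSφ (-t) ht
      rwa [← φ.map_add, neg_add_cancel, φ.map_zero_apply] at this)
    have hmono : StrictMono fun t => (φ t q).2 := strictMono_of_deriv_pos fun t => by
      rw [(hasDerivAt_height hφ q t).deriv]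
      exact (hR _).lt_of_ne fun h => hout t (hR0 _ h.symm)
    have h1 : 0 < (φ 1 q).2 := by
      simpa [h] using hmono (zero_lt_one' ℝ)
    refine not_isBounded_forward hφ hRc hR hR0 hS h1 (hb.subset ?_)
    rintro _ ⟨t, -, rfl⟩
    exact ⟨t + 1, φ.map_add t 1 q⟩
  · exact not_isBounded_forward hφ hRc hR hR0 hS h (hb.subset (image_subset_range _ _))

/-- If `S` is non-empty, some orbit enters from `z = -∞` and is trapped. By the intermediate value
theorem, for each `k` some point of the vertical segment below a point of `S` was at height `-1`
exactly `k` time units ago. The points where this happened lie in a compact disc, and the orbit of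
an accumulation point as `k → ∞` never gets to positive height. -/
theorem exists_trapped_orbit (hφ : IsFlowOf φ R) {K : NNReal} (hRL : LipschitzWith K R)
    (hR : ∀ q, 0 ≤ (R q).2) (hR0 : ∀ q, (R q).2 = 0 → q ∈ S) (hS : ∀ q ∈ S, q.2 = 0)
    (hSφ : IsInvariant φ S) (hSne : S.Nonempty) {L : ℝ}
    (hL : ∀ q : Space n, L < ‖q.1‖ → R q = (0, 1)) (hSL : ∀ q ∈ S, ‖q.1‖ ≤ L) :
    ∃ q, Bornology.IsBounded ((fun t => φ t q) '' Ici 0) ∧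
      ¬ Bornology.IsBounded ((fun t => φ t q) '' Iic 0) := by
  have hvert : ∀ q : Space n, L < ‖q.1‖ → ∀ t, φ t q = (q.1, q.2 + t) := by
    intro q hq t
    have h1 : IsIntegralCurve (fun t => ((q.1, q.2 + t) : Space n)) fun _ => R := fun t => by
      change HasDerivAt _ (R (q.1, q.2 + t)) t
      rw [hL (q.1, q.2 + t) hq]
      exact (hasDerivAt_const t q.1).prodMk ((hasDerivAt_id t).const_add q.2)
    exact congrFun ((hφ q).eq_of_lipschitzWith hRL h1 (by simp)) t
  have hback : ∀ (q : Space n) (t : ℝ), ‖(φ t q).1‖ ≤ L ↔ ‖q.1‖ ≤ L := by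
    have key : ∀ (q : Space n) (t : ℝ), ‖(φ t q).1‖ ≤ L → ‖q.1‖ ≤ L := by
      intro q t h
      by_contra hq
      rw [hvert q (not_le.1 hq)] at h
      exact hq h
    refine fun q t => ⟨key q t, fun h => key (φ t q) (-t) ?_⟩
    rwa [← φ.map_add, neg_add_cancel, φ.map_zero_apply]
  obtain ⟨⟨a, z⟩, ha⟩ := hSne
  obtain rfl : z = 0 := hS _ ha
  have hk : ∀ k : ℕ, ∃ q ∈ Metric.closedBall (0 : Plane n) L ×ˢ ({-1} : Set ℝ),
      (φ k q).2 ≤ 0 := by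
    intro k
    have hcont : Continuous fun s : ℝ => (φ (-k) ((a, s) : Space n)).2 := by fun_prop
    have h0 : (φ (-k) ((a, 0) : Space n)).2 = 0 := hS _ (hSφ _ ha)
    have h1 : (φ (-k) ((a, -1) : Space n)).2 ≤ -1 := by
      simpa using monotone_height hφ hR ((a, -1) : Space n)
        (show -(k : ℝ) ≤ 0 from neg_nonpos.2 k.cast_nonneg)
    obtain ⟨s, hs, hsk⟩ := intermediate_value_Icc (show (-1 : ℝ) ≤ 0 by norm_num)
      hcont.continuousOn ⟨h1, show (-1 : ℝ) ≤ (φ (-k) ((a, 0) : Space n)).2 by rw [h0]; norm_num⟩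
    refine ⟨φ (-k) (a, s), ⟨?_, hsk⟩, ?_⟩
    · rw [mem_closedBall_zero_iff, hback]
      exact hSL (a, 0) ha
    · rw [← φ.map_add, add_neg_cancel, φ.map_zero_apply]
      exact hs.2
  choose p hp hpk using hk
  obtain ⟨q, hq, σ, hσ, hlim⟩ :=
    ((isCompact_closedBall (0 : Plane n) L).prod isCompact_singleton).tendsto_subseq hp
  have hq2 : q.2 = -1 := hq.2
  have hneg : ∀ t, (φ t q).2 ≤ 0 := by
    intro t
    have h1 : Tendsto (fun k => (φ t (p (σ k))).2) atTop (𝓝 (φ t q).2) := by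
      have : Continuous fun x : Space n => (φ t x).2 := by fun_prop
      exact (this.tendsto q).comp hlim
    refine le_of_tendsto h1 ?_
    obtain ⟨m, hm⟩ := exists_nat_ge t
    filter_upwards [eventually_ge_atTop m] with k hk
    have h2 : t ≤ (σ k : ℝ) := hm.trans (by exact_mod_cast hk.trans (hσ.id_le k))
    exact (monotone_height hφ hR _ h2).trans (hpk _)
  refine ⟨q, ?_, not_isBounded_backward hφ hRL.continuous hR hR0 hS (by rw [hq2]; norm_num)⟩
  refine ((Metric.isBounded_closedBall (x := (0 : Plane n)) (r := L)).prod
    (Metric.isBounded_Icc (-1) 0)).subset ?_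
  rintro _ ⟨t, ht, rfl⟩
  refine ⟨?_, ?_, hneg t⟩
  · rw [mem_closedBall_zero_iff, hback]
    exact mem_closedBall_zero_iff.1 hq.1
  · simpa [hq2] using monotone_height hφ hR q ht

end HeightDynamics

/-! ### The Reeb flow of a compactly supported deformation -/

section CompactlySupported

variable {n : ℕ} {η : Space n → ℝ}

theorem contDiff_reebField (hη : ContDiff ℝ ∞ η) : ContDiff ℝ ∞ (reebField η) := by
  have h1 : ContDiff ℝ ∞ (fderiv ℝ η) := hη.fderiv_right (m := ∞) (by simp)
  have h2 : ∀ v, ContDiff ℝ ∞ fun q => fderiv ℝ η q v := fun v => h1.clm_apply contDiff_const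
  have h3 : ContDiff ℝ ∞ fun q : Space n => fderiv ℝ η q (q.1, 0) :=
    h1.clm_apply (contDiff_fst.prodMk contDiff_const)
  have h4 : ∀ j : Fin n, ContDiff ℝ ∞ fun q : Space n => q.1 j := fun j => by fun_prop
  refine (Real.contDiff_exp.comp hη).smul (ContDiff.prodMk (contDiff_pi.2 fun j => ?_)
    (contDiff_const.sub (contDiff_const.mul h3)))
  exact ((h2 _).neg.add (((h4 j).fst.div_const 2).mul (h2 _))).prodMk
    ((h2 _).add (((h4 j).snd.div_const 2).mul (h2 _)))

theorem reebField_of_notMem_tsupport {q : Space n} (hq : q ∉ tsupport η) :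
    reebField η q = (0, 1) := by
  have h1 : η q = 0 := image_eq_zero_of_notMem_tsupport hq
  have h2 : fderiv ℝ η q = 0 := fderiv_of_notMem_tsupport ℝ hq
  ext <;> simp [reebField, h1, h2]

theorem reebField_snd (q : Space n) :
    (reebField η q).2 = Real.exp (η q) * (1 - 1 / 2 * fderiv ℝ η q (q.1, 0)) := rfl

theorem exists_bound_lipschitzWith_reebField (hη : ContDiff ℝ ∞ η) (hηc : HasCompactSupport η) :
    ∃ (C : ℝ) (K : NNReal), (∀ q, ‖reebField η q‖ ≤ C) ∧ LipschitzWith K (reebField η) := by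
  let G : Space n → Space n := fun q => reebField η q - (0, 1)
  have hG : ContDiff ℝ ∞ G := (contDiff_reebField hη).sub contDiff_const
  have hGc : HasCompactSupport G := HasCompactSupport.intro' hηc (isClosed_tsupport η) fun q hq => by
    simp [G, reebField_of_notMem_tsupport hq]
  obtain ⟨C, hC⟩ := hGc.exists_bound_of_continuous hG.continuous
  obtain ⟨K, hK⟩ := ContDiff.lipschitzWith_of_hasCompactSupport hGc hG (by simp)
  refine ⟨C + ‖((0, 1) : Space n)‖, K, fun q => ?_, fun x y => ?_⟩
  · have h : reebField η q = G q + (0, 1) := by simp [G]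
    rw [h]
    exact (norm_add_le _ _).trans (add_le_add_left (hC q) _)
  · simpa [G] using hK x y

end CompactlySupported

/-! ### The angular components of a torus field -/

section Angular

variable {n : ℕ} {V : Plane n → Plane n}

theorem contDiffOn_dTheta (hV : ContDiffOn ℝ ∞ V (torus n)) (j : Fin n) :
    ContDiffOn ℝ ∞ (fun p => dTheta j p (V p)) (torus n) := by
  have h1 : ContDiffOn ℝ ∞ (fun p => V p j) (torus n) := contDiffOn_pi.1 hV j
  have h2 : ContDiffOn ℝ ∞ (fun p : Plane n => p j) (torus n) :=
    (contDiff_apply ℝ (ℝ × ℝ) j).contDiffOn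
  refine ContDiffOn.div ((h2.fst.mul h1.snd).sub (h2.snd.mul h1.fst))
    (contDiff_normSq.comp_contDiffOn h2) fun p hp => ?_
  have := mem_torus_iff.1 hp j
  exact this.trans_ne one_ne_zero

/-- A vector tangent to the torus is determined by its angular components. -/
theorem torusField_apply_eq (hV : IsTorusField n V) {p : Plane n} (hp : p ∈ torus n)
    (j : Fin n) : V p j = (-(dTheta j p (V p) * (p j).2), dTheta j p (V p) * (p j).1) := by
  have h1 : (p j).1 ^ 2 + (p j).2 ^ 2 = 1 := mem_torus_iff.1 hp j
  have h2 := hV.2 p hp j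
  ext
  · simp only [dTheta, h1, div_one]
    linear_combination -(V p j).1 * h1 + (p j).1 * h2
  · simp only [dTheta, h1, div_one]
    linear_combination -(V p j).2 * h1 + (p j).2 * h2

end Angular

theorem theorem1 (n : ℕ) (V : Plane n → Plane n) (hV : IsTorusField n V)
    (hpos : ∀ p ∈ torus n, 0 < ∑ j, dTheta j p (V p))
    (A : Set (Plane n)) (hAT : A ⊆ torus n) (hAc : IsCompact A) (hAne : A.Nonempty)
    (hAinv : IsInvariantIn n V A) :
    ∃ α : Space n → Space n →L[ℝ] ℝ, IsContactForm n α ∧ DefinesXiSt n α ∧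
      -- (1) `α = α_st` outside a compact neighbourhood of `A × {0}`
      (∃ K : Set (Space n), IsCompact K ∧ K ∈ 𝓝ˢ (A ×ˢ ({0} : Set ℝ)) ∧
        ∀ q, q ∉ K → α q = alphaSt n q) ∧
      -- the Reeb vector field `R` of `α` and its flow `φ`
      ∃ (R : Space n → Space n) (φ : Flow ℝ (Space n)), IsReebField α R ∧ IsFlowOf φ R ∧
        -- (2)
        (IsInvariant φ (A ×ˢ ({0} : Set ℝ)) ∧
          ∃ f : Plane n → ℝ, ContDiffOn ℝ ∞ f (torus n) ∧ (∀ p ∈ torus n, 0 < f p) ∧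
            ∀ p ∈ A, R (p, 0) = (f p • V p, 0)) ∧
        -- (3)
        (∀ q, q ∉ A ×ˢ ({0} : Set ℝ) → ¬ Bornology.IsBounded (φ.orbit q)) ∧
        -- (4)
        (∃ q, Bornology.IsBounded ((fun t => φ t q) '' Ici (0 : ℝ)) ∧
          ¬ Bornology.IsBounded ((fun t => φ t q) '' Iic (0 : ℝ))) := by
  have hn : 0 < n := by
    rcases Nat.eq_zero_or_pos n with rfl | hn
    · obtain ⟨a, ha⟩ := hAne
      simpa using hpos a (hAT ha)
    · exact hn
  -- the function `f` normalizes the sum of the angular components of `f V` to `2`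
  let f : Plane n → ℝ := fun p => 2 / ∑ j, dTheta j p (V p)
  have hfs : ContDiffOn ℝ ∞ f (torus n) :=
    contDiffOn_const.div (ContDiffOn.sum fun j _ => contDiffOn_dTheta hV.1 j)
      fun p hp => (hpos p hp).ne'
  have hf0 : ∀ p ∈ torus n, 0 < f p := fun p hp => div_pos two_pos (hpos p hp)
  let h : Fin n → Plane n → ℝ := fun j p => f p * dTheta j p (V p)
  have hh : ∀ j, ContDiffOn ℝ ∞ (h j) (torus n) := fun j => hfs.mul (contDiffOn_dTheta hV.1 j)
  have hsum : ∀ p ∈ torus n, ∑ j, h j p = 2 := fun p hp => by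
    simp only [h, f, ← Finset.mul_sum]
    exact div_mul_cancel₀ _ (hpos p hp).ne'
  obtain ⟨η, hη, hηc, hE, hE2, hηA⟩ := exists_logHamiltonian hn hh hsum hAT hAc
  obtain ⟨C, K, hC, hK⟩ := exists_bound_lipschitzWith_reebField hη hηc
  obtain ⟨φ, hφ⟩ := exists_isFlowOf_of_lipschitzWith hK hC
  have hRA : ∀ p ∈ A, reebField η (p, 0) = (f p • V p, 0) := by
    intro p hp
    obtain ⟨h0, hd⟩ := hηA p hp
    have hx : ∀ j, fderiv ℝ η (p, 0) (Pi.single j (1, 0), 0) = h j p * (p j).1 := by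
      intro j
      rw [hd, Finset.sum_eq_single j]
      · simp
      · intro k _ hk
        simp [Pi.single_eq_of_ne hk]
      · simp
    have hy : ∀ j, fderiv ℝ η (p, 0) (Pi.single j (0, 1), 0) = h j p * (p j).2 := by
      intro j
      rw [hd, Finset.sum_eq_single j]
      · simp
      · intro k _ hk
        simp [Pi.single_eq_of_ne hk]
      · simp
    have hz : fderiv ℝ η (p, 0) (0, 1) = 0 := by simp [hd]
    have hEp : fderiv ℝ η (p, 0) (p, 0) = 2 := (hE2 (p, 0)).2 ⟨hp, rfl⟩
    refine Prod.ext (funext fun j => ?_) ?_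
    · change _ = f p • V p j
      rw [torusField_apply_eq hV (hAT hp) j]
      simp [reebField, h0, hx, hy, hz, h, mul_assoc]
    · rw [reebField_snd, hEp]
      norm_num
  have hR : ∀ q, 0 ≤ (reebField η q).2 := fun q => by
    rw [reebField_snd]
    exact mul_nonneg (Real.exp_pos _).le (by linarith [hE q])
  have hR0 : ∀ q, (reebField η q).2 = 0 → q ∈ A ×ˢ ({0} : Set ℝ) := fun q hq => by
    rw [reebField_snd] at hq
    have := (mul_eq_zero.1 hq).resolve_left (Real.exp_pos _).ne'
    exact (hE2 q).1 (by linarith)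
  have hS : ∀ q ∈ A ×ˢ ({0} : Set ℝ), q.2 = 0 := fun q hq => hq.2
  have hinv : IsInvariant φ (A ×ˢ ({0} : Set ℝ)) := by
    rintro t ⟨a, z⟩ ⟨ha, hz⟩
    obtain rfl : z = 0 := hz
    obtain ⟨β, hβ0, hβA, hβ⟩ := exists_isIntegralCurve_smul hV hAT hAinv hfs ha
    have h1 : IsIntegralCurve (fun t => ((β t, 0) : Space n)) fun _ => reebField η := fun t => by
      change HasDerivAt _ (reebField η (β t, 0)) t
      rw [hRA _ (hβA t)]
      exact (hβ t).prodMk (hasDerivAt_const t 0)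
    have h2 := congrFun ((hφ (a, 0)).eq_of_lipschitzWith hK h1 (by simp [hβ0])) t
    change φ t (a, 0) ∈ _
    rw [h2]
    exact ⟨hβA t, rfl⟩
  obtain ⟨L, hL⟩ := (hηc.isCompact.union (hAc.prod isCompact_singleton)).isBounded.exists_norm_le
  refine ⟨expForm η, isContactForm_expForm hη, definesXiSt_expForm η,
    ⟨Metric.closedBall 0 (L + 1), isCompact_closedBall 0 (L + 1), ?_, fun q hq => ?_⟩,
    reebField η, φ, isReebField_reebField hη, hφ, ⟨hinv, f, hfs, hf0, hRA⟩,
    fun q hq => not_isBounded_orbit hφ hK.continuous hR hR0 hS hinv hq,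
    exists_trapped_orbit hφ hK hR hR0 hS hinv (hAne.prod (singleton_nonempty 0)) (L := L) ?_ ?_⟩
  · rw [mem_nhdsSet_iff_forall]
    intro q hq
    refine mem_of_superset (Metric.isOpen_ball.mem_nhds ?_) Metric.ball_subset_closedBall
    rw [mem_ball_zero_iff]
    linarith [hL q (Or.inr hq)]
  · have : η q = 0 := image_eq_zero_of_notMem_tsupport fun h => hq (by
      rw [mem_closedBall_zero_iff]
      linarith [hL q (Or.inl h)])
    simp [expForm, this]
  · intro q hq
    refine reebField_of_notMem_tsupport fun h => ?_
    exact absurd ((norm_fst_le q).trans (hL q (Or.inl h))) (not_le.2 hq)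
  · exact fun q hq => (norm_fst_le q).trans (hL q (Or.inr hq))
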